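/- Conventions. Let $\mathcal T$ be a triangulated category with (small) coproducts and suspension $\Sigma$, and let $\mathcal T^c$ be its full subcategory of compact objects. A *compact generator* is a compact object $G$ such that $\mathrm{Hom}(\Sigma^iG,X)=0$ for all $i\in\mathbb Z$ implies $X=0$. For full subcategories $\mathcal A,\mathcal B$, let $\mathcal A\star\mathcal B$ be the full subcategory of all $y$ admitting a triangle $a\to y\to b\to\Sigma a$ with $a\in\mathcal A$, $b\in\mathcal B$. For an object $G$, a set $S\subset\mathbb Z$ and $n\ge1$, let $\mathrm{Coprod}_1(G(S))$ consist of all small coproducts of objects $\Sigma^{-i}G$ with $i\in S$, let $\mathrm{Coprod}_{n+1}(G(S))=\mathrm{Coprod}_1(G(S))\star\mathrm{Coprod}_n(G(S))$, and let $\mathrm{Coprod}(G(S))$ be the smallest full subcategory containing these $\Sigma^{-i}G$ and closed under small coproducts and extensions. Let $\overline{\langle G\rangle}{}_n^{S}$ and $\overline{\langle G\rangle}{}^{S}$ be the full subcategories of direct summands of objects of $\mathrm{Coprod}_n(G(S))$ and $\mathrm{Coprod}(G(S))$. * $\mathcal T$ is *approximable* if there are a compact generator $G$, a $t$-structure $(\mathcal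 T^{\le0},\mathcal T^{\ge0})$ and an integer $A>0$ such that $\Sigma^AG\in\mathcal T^{\le0}$, $\mathrm{Hom}(\Sigma^{-A}G,\mathcal T^{\le0})=0$, and every $F\in\mathcal T^{\le0}$ admits a triangle $E\to F\to D\to\Sigma E$ with $E\in\overline{\langle G\rangle}{}_A^{[-A,A]}$ and $D\in\mathcal T^{\le-1}$. * A $t$-structure is *preferred* if it is equivalent to the one generated by a compact generator, that is, if there are a compact generator $G$ and an integer $A>0$ with $\overline{\langle G\rangle}{}^{(-\infty,-A]}\subset\mathcal T^{\le0}\subset\overline{\langle G\rangle}{}^{(-\infty,A]}$. * Given a $t$-structure, put $\mathcal T^-=\bigcup_m\mathcal T^{\le m}$, $\mathcal T^+=\bigcup_m\mathcal T^{\ge-m}$, $\mathcal T^b=\mathcal T^-\cap\mathcal T^+$. The subcategory $\mathcal T^-_c$ consists of all $F$ such that for every $m>0$ there is a triangle $E\to F\to D\to\Sigma E$ with $E\in\mathcal T^c$ and $D\in\mathcal T^{\le-m}$; and $\mathcal T^b_c=\mathcal T^-_c\cap\mathcal T^b$. * If $R$ is a commutative noetherian ring and $\mathcal T$ is $R$-linear,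 a *$\mathcal T^c$-cohomological functor* is an $R$-linear functor $H:(\mathcal T^c)^{op}\to\mathrm{Mod}\,R$ taking triangles with vertices in $\mathcal T^c$ to long exact sequences. For $G\in\mathcal T^c$ it is *$G$-locally finite* if $H(\Sigma^iG)$ is a finite $R$-module for all $i$ and vanishes for $i\ll0$; it is *locally finite* if this holds for every $G\in\mathcal T^c$, and *finite* if moreover, for every $G\in\mathcal T^c$, $H(\Sigma^iG)=0$ for $i\gg0$. Theorem. Let $R$ be a commutative noetherian ring and $\mathcal T$ an $R$-linear triangulated category with coproducts. Assume that $\mathcal T$ is approximable and has a compact generator $G$ such that $\mathrm{Hom}(-,G)$ is $G$-locally finite. Let $\mathcal Y:\mathcal T\to\mathrm{Hom}\big((\mathcal T^c)^{op},\mathrm{Mod}\,R\big)$ be the restricted Yoneda functor, $\mathcal Y(t)=\mathrm{Hom}(-,t)|_{\mathcal T^c}$. Then preferred $t$-structures exist and, for $\mathcal T^+$, $\mathcal T^-_c$, $\mathcal T^b_c$ formed with any preferred $t$-structure: 1. Every morphism $\varphi:\mathcal Y(s)\to\mathcal Y(t)$ with $s\in\mathcal T^-_c$ and $t\in\mathcal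 T$ is equal to $\mathcal Y(f)$ for some $f:s\to t$; in particular $\mathcal Y$ is full on $\mathcal T^-_c$. 2. The essential image of $\mathcal T^-_c$ under $\mathcal Y$ consists exactly of the locally finite $\mathcal T^c$-cohomological functors. 3. If $f:s\to t$ is a morphism with $s\in\mathcal T^-_c$, $t\in\mathcal T^+$ and $\mathcal Y(f)=0$, then $f=0$. 4. $\mathcal Y$ is fully faithful on $\mathcal T^b_c$, and the essential image of $\mathcal T^b_c$ consists exactly of the finite $\mathcal T^c$-cohomological functors. -/

import Mathlib

open CategoryTheory CategoryTheory.Limits CategoryTheory.Pretriangulated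
  CategoryTheory.Triangulated Opposite

universe w v u

namespace ApproxTriang

section Compact

variable (C : Type u) [Category.{v} C] [Preadditive C]

/-- The compact objects: `Hom(X, -)`, as a functor to abelian groups, commutes with all small
coproducts.  As a full subcategory this is `𝒯ᶜ`. -/
def isCompact : ObjectProperty C := fun X =>
  ∀ J : Type v, PreservesColimitsOfShape (Discrete J) (preadditiveCoyoneda.obj (op X))

variable {C} in
lemma isCompact_of_iso_comp {X Y : C} (F : C ⥤ C) [F.IsEquivalence]
    (e : preadditiveCoyoneda.obj (op Y) ≅ F ⋙ preadditiveCoyoneda.obj (op X))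
    (hX : isCompact C X) : isCompact C Y := fun J => by
  have := hX J
  exact preservesColimitsOfShape_of_natIso e.symm

variable [HasShift C ℤ] [∀ n : ℤ, (shiftFunctor C n).Additive]

variable {C} in
/-- The natural isomorphism `Hom(X⟦n⟧, -) ≅ Hom(X, (-)⟦-n⟧)`. -/
noncomputable def coyonedaShiftIso (X : C) (n : ℤ) :
    preadditiveCoyoneda.obj (op (X⟦n⟧)) ≅
      shiftFunctor C (-n) ⋙ preadditiveCoyoneda.obj (op X) :=
  haveI : (shiftEquiv C n).functor.Additive := inferInstanceAs (shiftFunctor C n).Additive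
  NatIso.ofComponents
    (fun Y => AddEquiv.toAddCommGrpIso
      ((shiftEquiv C n).toAdjunction.homAddEquiv X Y))
    (fun {Y Z} f => by
      ext g
      exact (shiftEquiv C n).toAdjunction.homEquiv_naturality_right g f)

instance : (isCompact C).IsStableUnderShift ℤ where
  isStableUnderShiftBy n :=
    { le_shift := fun X hX => isCompact_of_iso_comp _ (coyonedaShiftIso X n) hX }

variable {C} in
/-- `G` is a (single) compact generator: `G` is compact, and an object `X` with
`Hom(Σⁱ G, X) = 0` for all `i ∈ ℤ` vanishes. -/
structure IsCompactGenerator (G : C) : Prop where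
  isCompact : isCompact C G
  isZero : ∀ X : C, (∀ (i : ℤ) (f : G⟦i⟧ ⟶ X), f = 0) → IsZero X

end Compact

section Coprod

variable {C : Type u} [Category.{v} C] [Preadditive C] [HasZeroObject C] [HasShift C ℤ]
  [∀ n : ℤ, (shiftFunctor C n).Additive] [Pretriangulated C]

/-- The objects `Σ⁻ⁱ G` with `i ∈ S`, for a set `S` of integers. -/
def shiftsIn (G : C) (S : Set ℤ) : ObjectProperty C := fun X =>
  ∃ i ∈ S, Nonempty (X ≅ G⟦-i⟧)

/-- `Add(P)`: all small coproducts of objects of `P`. -/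
def addClosure (P : ObjectProperty C) : ObjectProperty C := fun X =>
  ∃ J : Type v, P.colimitsOfShape (Discrete J) X

/-- `Coprodₙ(G(S))` for `n ≥ 1`: `Coprod₁ = Add {Σ⁻ⁱ G | i ∈ S}` and
`Coprodₙ₊₁ = Coprod₁ ⋆ Coprodₙ`, where `extensionProduct` is the operation `⋆`
(the value at `n = 0` is irrelevant). -/
def coprodN (G : C) (S : Set ℤ) : ℕ → ObjectProperty C
  | 0 => addClosure (shiftsIn G S)
  | 1 => addClosure (shiftsIn G S)
  | n + 2 => ObjectProperty.extensionProduct (addClosure (shiftsIn G S)) (coprodN G S (n + 1))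

/-- `Coprod(G(S))`: the smallest full subcategory which contains `Σ⁻ⁱ G` for `i ∈ S` and is
closed under small coproducts and extensions. -/
inductive coprodClosure (G : C) (S : Set ℤ) : ObjectProperty C
  | of (X : C) (hX : shiftsIn G S X) : coprodClosure G S X
  | coproduct {J : Type v} (F : J → C) (hF : ∀ j, coprodClosure G S (F j)) (c : Cofan F)
      (hc : IsColimit c) : coprodClosure G S c.pt
  | ext (T : Triangle C) (hT : T ∈ distTriang C) (h₁ : coprodClosure G S T.obj₁)
      (h₃ : coprodClosure G S T.obj₃) : coprodClosure G S T.obj₂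

/-- The aisle, shifted by `n`, of the `t`-structure generated by `G`: the direct summands of
objects of `Coprod(G(-∞, n])`. -/
def aisle (G : C) (n : ℤ) : ObjectProperty C :=
  (coprodClosure G (Set.Iic n)).retractClosure

/-- `t` lies in the preferred equivalence class: for a compact generator `G`, the aisle of `t` and
the aisle generated by `G` satisfy `𝒯_G^{≤ -A} ⊆ 𝒯^{≤ 0} ⊆ 𝒯_G^{≤ A}` for some `A > 0`. -/
def IsPreferred (t : TStructure C) : Prop :=
  ∃ G : C, IsCompactGenerator G ∧
    ∃ A : ℤ, 0 < A ∧ aisle G (-A) ≤ t.le 0 ∧ t.le 0 ≤ aisle G A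

variable (C) in
/-- Approximability: there are a compact generator `G`, a `t`-structure and an integer `A > 0`
such that `Σᴬ G ∈ 𝒯^{≤ 0}`, `Hom(Σ⁻ᴬ G, 𝒯^{≤ 0}) = 0`, and every `F ∈ 𝒯^{≤ 0}` sits in a triangle
`E ⟶ F ⟶ D ⟶` where `D ∈ 𝒯^{≤ -1}` and `E` is a direct summand of an object of
`Coprod_A(G[-A, A])`. -/
def IsApproximable : Prop :=
  ∃ (G : C) (t : TStructure C) (A : ℕ), IsCompactGenerator G ∧ 0 < A ∧
    t.le 0 (G⟦(A : ℤ)⟧) ∧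
    (∀ (Y : C), t.le 0 Y → ∀ f : G⟦-(A : ℤ)⟧ ⟶ Y, f = 0) ∧
    ∀ F : C, t.le 0 F →
      ∃ (E D : C) (a : E ⟶ F) (b : F ⟶ D) (c : D ⟶ E⟦(1 : ℤ)⟧),
        Triangle.mk a b c ∈ distTriang C ∧
        (coprodN G (Set.Icc (-(A : ℤ)) A) A).retractClosure E ∧ t.le (-1) D

/-- `𝒯⁻_c` with respect to `t`: the `F` such that for every `m > 0` there is a triangle
`E ⟶ F ⟶ D ⟶` with `E` compact and `D ∈ 𝒯^{≤ -m}`. -/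
def minusC (t : TStructure C) : ObjectProperty C := fun F =>
  ∀ m : ℤ, 0 < m → ∃ (E D : C) (a : E ⟶ F) (b : F ⟶ D) (c : D ⟶ E⟦(1 : ℤ)⟧),
    Triangle.mk a b c ∈ distTriang C ∧ isCompact C E ∧ t.le (-m) D

/-- `𝒯ᵇ_c = 𝒯⁻_c ∩ 𝒯ᵇ`. -/
def boundedC (t : TStructure C) : ObjectProperty C := minusC t ⊓ t.bounded

end Coprod

section Cohomological

variable (R : Type w) [CommRing R] {C : Type u} [Category.{v} C] [Preadditive C] [Linear R C]

/-- The restricted Yoneda functor, sending `t` to `Hom(-, t)` restricted to the full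
subcategory `P`. -/
def restrictedYoneda (P : ObjectProperty C) : C ⥤ P.FullSubcategoryᵒᵖ ⥤ ModuleCat.{v} R :=
  linearYoneda R C ⋙ (Functor.whiskeringLeft _ _ _).obj P.ι.op

variable (C) in
/-- The restricted Yoneda functor `𝒴 : 𝒯 ⥤ Hom((𝒯ᶜ)ᵒᵖ, Mod R)`. -/
abbrev compactYoneda : C ⥤ (isCompact C).FullSubcategoryᵒᵖ ⥤ ModuleCat.{v} R :=
  restrictedYoneda R (isCompact C)

variable [HasZeroObject C] [HasShift C ℤ] [∀ n : ℤ, (shiftFunctor C n).Additive]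
  [Pretriangulated C]

variable {R} {P : ObjectProperty C}

/-- `H` is a `P`-cohomological functor: it is `R`-linear, and takes triangles `X ⟶ Y ⟶ Z ⟶ X⟦1⟧`
with vertices in `P` to exact sequences.  Since the rotations of such a triangle again have their
vertices in `P`, exactness at `H Y` for all of them is exactness of the long sequences. -/
structure IsCohomological [P.IsStableUnderShift ℤ] (H : P.FullSubcategoryᵒᵖ ⥤ ModuleCat.{v} R) :
    Prop where
  map_add : ∀ {X Y : P.FullSubcategory} (f g : X ⟶ Y), H.map (f + g).op = H.map f.op + H.map g.op
  map_smul : ∀ {X Y : P.FullSubcategory} (r : R) (f : X ⟶ Y), H.map (r • f).op = r • H.map f.op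
  exact : ∀ {X Y Z : P.FullSubcategory} (f : X ⟶ Y) (g : Y ⟶ Z) (h : Z.obj ⟶ X.obj⟦(1 : ℤ)⟧),
    Triangle.mk f.hom g.hom h ∈ distTriang C → Function.Exact (H.map g.op) (H.map f.op)

/-- The object `Σⁱ G` of the full subcategory `P`. -/
abbrev shiftObj [P.IsStableUnderShift ℤ] (G : P.FullSubcategory) (i : ℤ) : P.FullSubcategory :=
  ⟨G.obj⟦i⟧, P.le_shift i _ G.property⟩

/-- `H(Σⁱ G)` is a finite `R`-module for all `i`, and vanishes for `i ≪ 0`. -/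
structure IsLocallyFiniteAt [P.IsStableUnderShift ℤ] (H : P.FullSubcategoryᵒᵖ ⥤ ModuleCat.{v} R)
    (G : P.FullSubcategory) : Prop where
  finite : ∀ i : ℤ, Module.Finite R (H.obj (op (shiftObj G i)))
  isZero_of_le : ∃ N : ℤ, ∀ i ≤ N, IsZero (H.obj (op (shiftObj G i)))

/-- `H` is a locally finite `P`-cohomological functor. -/
structure IsLocallyFinite [P.IsStableUnderShift ℤ] (H : P.FullSubcategoryᵒᵖ ⥤ ModuleCat.{v} R) :
    Prop extends IsCohomological H where
  locallyFiniteAt : ∀ G : P.FullSubcategory, IsLocallyFiniteAt H G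

/-- `H` is a finite `P`-cohomological functor: it is locally finite and, for every `G` in `P`,
`H(Σⁱ G)` also vanishes for `i ≫ 0`. -/
structure IsFinite [P.IsStableUnderShift ℤ] (H : P.FullSubcategoryᵒᵖ ⥤ ModuleCat.{v} R) :
    Prop extends IsLocallyFinite H where
  isZero_of_ge : ∀ G : P.FullSubcategory, ∃ N : ℤ, ∀ i ≥ N, IsZero (H.obj (op (shiftObj G i)))

end Cohomological

end ApproxTriang

/-!
A cohomological functor on the compact objects sees an object `F` only through the morphisms from
compact objects.  An object of `𝒯⁻_c` is the homotopy colimit of compact objects `E n` whose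
distance to `F`, measured by the t-structure, tends to zero (`isHocolim_of_triangles`).  This gives
fullness, since compatible morphisms from the `E n` extend to their homotopy colimit
(`ApproxData.exists_map_eq`).  A morphism from `F` to an object bounded below which vanishes on a
good enough `E n` factors through an object too far down to have nonzero morphisms to the target
(`eq_zero_of_compactYoneda_map_eq_zero`).

The main point is that every locally finite functor `H` comes from an object of `𝒯⁻_c`.  Since
morphisms between compact objects form finite modules, one can build a sequence of compact objects
with compatible elements of `H` which, at the shifts of a generator, exhausts `H` in the colimit; so
`H` is represented by the homotopy colimit `F` of the sequence (`IsCohomological.exists_iso`).  This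
uses neither approximability nor the vanishing of `H` in low degrees.  The vanishing implies that
`F` is bounded above: a truncation of `F` is a direct summand of the error term of its approximation
(`ApproxData.minus_of_hom_eq_zero`).

It remains to see that an object `F` of `𝒯^{≤ N}` with finite morphism modules lies in `𝒯⁻_c`, and
for this it suffices to find a morphism with compact fibre from `F` to an object of `𝒯^{≤ N - 1}`
(`ApproxData.exists_hasFibreIn_isCompact`).  Approximability bounds by `A` the number of steps in
which an object of `𝒯^{≤ N}` is built from the generator up to an error in `𝒯^{≤ N - 1}`.  Hence, by
the ghost lemma, it suffices to kill, `A` times, finitely many generators of the morphisms from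
finitely many shifts of the generator: after this the morphism from `F` factors through
`𝒯^{≤ N - 1}`, while its fibre is compact and bounded (`ApproxData.exists_comp_factor`).  Such a
morphism `u ≫ w` need not have a target in `𝒯^{≤ N - 1}`; but if `u` and `w` take enough steps, then
bounds on the fibres show that `w`, up to a morphism which factors through a negligible object,
factors through a morphism `r` from the shifted fibre of `u`, and the cone of `r` is the required
target.

Both the choice of the generator and that of the preferred t-structure are immaterial, because
a triangulated subcategory closed under direct summands which contains a compact generator contains
all compact objects (`IsCompactGenerator.isCompact_le`).
-/

set_option linter.unusedSectionVars false

namespace ApproxTriang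

/-! ### Compact objects -/

section CompactObjects

open scoped Classical ZeroObject

/-- Elements of a coproduct of abelian groups have finite support. -/
lemma exists_eq_sum_of_coproduct {J : Type v} (A : J → AddCommGrpCat.{v})
    (x : (∐ A : AddCommGrpCat.{v})) :
    ∃ s : Finset J, x = ∑ j ∈ s, (Sigma.π A j ≫ Sigma.ι A j) x := by
  let S : AddSubgroup (∐ A : AddCommGrpCat.{v}) := ⨆ j, (Sigma.ι A j).hom.range
  have hS : S = ⊤ := by
    have h0 : AddCommGrpCat.ofHom (QuotientAddGroup.mk' S) = 0 := by
      refine Sigma.hom_ext _ _ fun j => ?_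
      ext a
      have ha : (Sigma.ι A j) a ∈ S :=
        (le_iSup (fun j => (Sigma.ι A j).hom.range) j) ⟨a, rfl⟩
      simpa using ha
    rw [eq_top_iff]
    intro y _
    have := ConcreteCategory.congr_hom h0 y
    simpa using this
  have hx : x ∈ S := hS ▸ AddSubgroup.mem_top x
  -- it suffices to treat the elements of the individual summands
  suffices h : ∃ s : Finset J, ∀ s' : Finset J, s ⊆ s' →
      x = ∑ j ∈ s', (Sigma.π A j ≫ Sigma.ι A j) x by
    obtain ⟨s, hs⟩ := h
    exact ⟨s, hs s subset_rfl⟩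
  induction hx using AddSubgroup.iSup_induction' with
  | hp j y hy =>
    obtain ⟨a, rfl⟩ := hy
    refine ⟨{j}, fun s' hs' => ?_⟩
    rw [Finset.sum_eq_single j]
    · have := ConcreteCategory.congr_hom (Sigma.ι_π_eq_id A j) a
      simp only [ConcreteCategory.comp_apply] at this ⊢
      exact (congrArg (Sigma.ι A j) this).symm
    · intro k _ hk
      have := ConcreteCategory.congr_hom (Sigma.ι_π_of_ne A hk.symm) a
      simp only [ConcreteCategory.comp_apply] at this ⊢
      exact (congrArg (Sigma.ι A k) this).trans (map_zero _)
    · intro h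
      exact absurd (hs' (Finset.mem_singleton_self j)) h
  | h1 => exact ⟨∅, fun s' _ => by simp⟩
  | hadd y z _ _ hy hz =>
    obtain ⟨s, hs⟩ := hy
    obtain ⟨t, ht⟩ := hz
    refine ⟨s ∪ t, fun s' hs' => ?_⟩
    simp only [map_add, Finset.sum_add_distrib]
    rw [← hs s' (Finset.union_subset_left hs'), ← ht s' (Finset.union_subset_right hs')]

variable {C : Type u} [Category.{v} C] [Preadditive C] [HasCoproducts.{v} C]

/-- A morphism to a coproduct has finite support: it is the sum of finitely many of its
components. -/
def HasFiniteSupport {J : Type v} {X : J → C} {K : C} (f : K ⟶ ∐ X) : Prop :=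
  ∃ s : Finset J, f = ∑ j ∈ s, f ≫ Sigma.π X j ≫ Sigma.ι X j

lemma HasFiniteSupport.comp_π_eq_zero {J : Type v} {X : J → C} {K : C} {f : K ⟶ ∐ X}
    {s : Finset J} (hs : f = ∑ j ∈ s, f ≫ Sigma.π X j ≫ Sigma.ι X j) {j : J} (hj : j ∉ s) :
    f ≫ Sigma.π X j = 0 := by
  rw [hs, Preadditive.sum_comp]
  refine Finset.sum_eq_zero fun k hk => ?_
  have : k ≠ j := fun h => hj (h ▸ hk)
  simp [Sigma.ι_π_of_ne X this]

lemma HasFiniteSupport.eq_zero {J : Type v} {X : J → C} {K : C} {f : K ⟶ ∐ X}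
    (hf : HasFiniteSupport f) (h : ∀ j, f ≫ Sigma.π X j = 0) : f = 0 := by
  obtain ⟨s, hs⟩ := hf
  rw [hs]
  exact Finset.sum_eq_zero fun j _ => by rw [← Category.assoc, h, zero_comp]

lemma sigmaComparison_comp_map_π (F : C ⥤ AddCommGrpCat.{v}) [F.Additive] {J : Type v}
    (X : J → C) (j : J) :
    sigmaComparison F X ≫ F.map (Sigma.π X j) = Sigma.π (fun j => F.obj (X j)) j := by
  refine Sigma.hom_ext _ _ fun k => ?_
  rw [ι_comp_sigmaComparison_assoc, ← F.map_comp]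
  by_cases h : k = j
  · subst h
    simp
  · rw [Sigma.ι_π_of_ne X h, Sigma.ι_π_of_ne (fun j => F.obj (X j)) h, F.map_zero]

/-- An object is compact if and only if every morphism from it to a small coproduct has finite
support. -/
lemma isCompact_iff (K : C) :
    isCompact C K ↔ ∀ {J : Type v} (X : J → C) (f : K ⟶ ∐ X), HasFiniteSupport f := by
  constructor
  · intro hK J X f
    have := hK J
    let F := preadditiveCoyoneda.obj (op K)
    let x := (inv (sigmaComparison F X)) (show F.obj (∐ X) from f)
    obtain ⟨s, hs⟩ := exists_eq_sum_of_coproduct (fun j => F.obj (X j)) x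
    have hx : (sigmaComparison F X) x = f :=
      ConcreteCategory.congr_hom (IsIso.inv_hom_id (sigmaComparison F X)) f
    have hπ := sigmaComparison_comp_map_π F X
    refine ⟨s, ?_⟩
    refine hx.symm.trans ?_
    conv_lhs => rw [hs]
    rw [map_sum]
    refine Finset.sum_congr rfl fun j _ => ?_
    rw [← hπ j]
    simp only [Category.assoc]
    rw [← ConcreteCategory.comp_apply]
    simp only [Category.assoc, ι_comp_sigmaComparison]
    rw [← F.map_comp, ConcreteCategory.comp_apply, hx]
    rfl
  · intro h J
    let F := preadditiveCoyoneda.obj (op K)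
    have : ∀ X : J → C, PreservesColimit (Discrete.functor X) F := fun X => by
      have hπ := sigmaComparison_comp_map_π F X
      have : IsIso (sigmaComparison F X) := by
        rw [ConcreteCategory.isIso_iff_bijective]
        constructor
        · rw [injective_iff_map_eq_zero]
          intro x hx
          obtain ⟨s, hs⟩ := exists_eq_sum_of_coproduct (fun j => F.obj (X j)) x
          rw [hs]
          refine Finset.sum_eq_zero fun j _ => ?_
          rw [← hπ j]
          simp only [ConcreteCategory.comp_apply, hx, map_zero]
        · intro f
          obtain ⟨s, hs⟩ := h X f
          refine ⟨∑ j ∈ s, (Sigma.ι (fun j => F.obj (X j)) j)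
            ((F.map (Sigma.π X j)) f), ?_⟩
          rw [map_sum]
          refine Eq.trans ?_ hs.symm
          refine Finset.sum_congr rfl fun j _ => ?_
          rw [← ConcreteCategory.comp_apply, ι_comp_sigmaComparison,
            ← ConcreteCategory.comp_apply, ← F.map_comp]
          rfl
      exact PreservesCoproduct.of_iso_comparison F X
    exact preservesColimitsOfShape_of_discrete F

/-- The endomorphism of a coproduct which projects to the summands in `s`. -/
noncomputable def partialId {J : Type v} (X : J → C) (s : Finset J) : ∐ X ⟶ ∐ X :=
  ∑ j ∈ s, Sigma.π X j ≫ Sigma.ι X j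

lemma comp_partialId {J : Type v} {X : J → C} (s : Finset J) {K : C} (f : K ⟶ ∐ X) :
    f ≫ partialId X s = ∑ j ∈ s, f ≫ Sigma.π X j ≫ Sigma.ι X j := by
  rw [partialId, Preadditive.comp_sum]

lemma HasFiniteSupport.of_comp_partialId {J : Type v} {X : J → C} {K : C} {f g : K ⟶ ∐ X}
    (s : Finset J) (h : f = g ≫ partialId X s) : HasFiniteSupport f := by
  refine ⟨s, ?_⟩
  rw [h, comp_partialId]
  refine Finset.sum_congr rfl fun j hj => ?_
  rw [Preadditive.sum_comp, Finset.sum_eq_single j]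
  · simp
  · intro k _ hk
    simp [Sigma.ι_π_of_ne_assoc X hk]
  · exact fun h => absurd hj h

lemma HasFiniteSupport.add {J : Type v} {X : J → C} {K : C} {f g : K ⟶ ∐ X}
    (hf : HasFiniteSupport f) (hg : HasFiniteSupport g) : HasFiniteSupport (f + g) := by
  obtain ⟨s, hs⟩ := hf
  obtain ⟨t, ht⟩ := hg
  refine .of_comp_partialId (s ∪ t) (g := f + g) ?_
  have key : ∀ {h : K ⟶ ∐ X} {r : Finset J}, r ⊆ s ∪ t →
      (h = ∑ j ∈ r, h ≫ Sigma.π X j ≫ Sigma.ι X j) → h = h ≫ partialId X (s ∪ t) := by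
    intro h r hr hh
    rw [comp_partialId, ← Finset.sum_subset hr, ← hh]
    intro j _ hj
    rw [← Category.assoc, HasFiniteSupport.comp_π_eq_zero hh hj, zero_comp]
  rw [Preadditive.add_comp, ← key Finset.subset_union_left hs, ← key Finset.subset_union_right ht]

lemma HasFiniteSupport.comp {J : Type v} {X : J → C} {K L : C} {f : K ⟶ ∐ X}
    (hf : HasFiniteSupport f) (g : L ⟶ K) : HasFiniteSupport (g ≫ f) := by
  obtain ⟨s, hs⟩ := hf
  refine ⟨s, ?_⟩
  conv_lhs => rw [hs]
  simp [Preadditive.comp_sum]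

instance : (isCompact C).IsStableUnderRetracts where
  of_retract {K L} r hL := by
    rw [isCompact_iff] at hL ⊢
    intro J X f
    have : f = r.i ≫ r.r ≫ f := by rw [← Category.assoc, r.retract, Category.id_comp]
    rw [this]
    exact (hL X (r.r ≫ f)).comp r.i

variable [HasZeroObject C] [HasShift C ℤ] [∀ n : ℤ, (shiftFunctor C n).Additive]
  [Pretriangulated C]

instance : (isCompact C).IsTriangulatedClosed₂ := .mk' fun T hT h₁ h₃ => by
  rw [isCompact_iff] at h₁ h₃ ⊢
  intro J X f
  -- Cutting off the support of the restriction to the first vertex leaves a morphism which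
  -- factors through the third vertex.
  obtain ⟨s, hs⟩ := h₁ X (T.mor₁ ≫ f)
  obtain ⟨g, hg⟩ := T.yoneda_exact₂ hT (f - f ≫ partialId X s) (by
    rw [Preadditive.comp_sub, ← Category.assoc, comp_partialId, ← hs, sub_self])
  have : f = f ≫ partialId X s + T.mor₂ ≫ g := by rw [← hg]; abel
  rw [this]
  exact (HasFiniteSupport.of_comp_partialId s rfl).add ((h₃ X g).comp _)

instance : (isCompact C).IsTriangulated where
  exists_zero := ⟨0, isZero_zero C, by
    rw [isCompact_iff]
    exact fun X f => ⟨∅, (isZero_zero C).eq_of_src _ _⟩⟩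

end CompactObjects

/-! ### Distinguished triangles -/

section Triangles

variable {C : Type u} [Category.{v} C] [Preadditive C] [HasZeroObject C] [HasShift C ℤ]
  [∀ n : ℤ, (shiftFunctor C n).Additive] [Pretriangulated C]

variable {X Y Z : C} {f : X ⟶ Y} {g : Y ⟶ Z} {k : Z ⟶ X⟦(1 : ℤ)⟧}

lemma tri_comp₁₂ (h : Triangle.mk f g k ∈ distTriang C) : f ≫ g = 0 :=
  comp_distTriang_mor_zero₁₂ _ h

lemma tri_comp₂₃ (h : Triangle.mk f g k ∈ distTriang C) : g ≫ k = 0 :=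
  comp_distTriang_mor_zero₂₃ _ h

lemma tri_comp₃₁ (h : Triangle.mk f g k ∈ distTriang C) : k ≫ f⟦(1 : ℤ)⟧' = 0 :=
  comp_distTriang_mor_zero₃₁ _ h

lemma tri_rot (h : Triangle.mk f g k ∈ distTriang C) :
    Triangle.mk g k (-f⟦(1 : ℤ)⟧') ∈ distTriang C :=
  rot_of_distTriang _ h

lemma tri_desc (h : Triangle.mk f g k ∈ distTriang C) {W : C} (φ : Y ⟶ W) (hφ : f ≫ φ = 0) :
    ∃ ψ : Z ⟶ W, g ≫ ψ = φ :=
  (Triangle.yoneda_exact₂ _ h φ hφ).imp fun _ h => h.symm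

lemma tri_desc₃ (h : Triangle.mk f g k ∈ distTriang C) {W : C} (φ : Z ⟶ W) (hφ : g ≫ φ = 0) :
    ∃ ψ : X⟦(1 : ℤ)⟧ ⟶ W, k ≫ ψ = φ :=
  (Triangle.yoneda_exact₃ _ h φ hφ).imp fun _ h => h.symm

lemma tri_lift (h : Triangle.mk f g k ∈ distTriang C) {W : C} (φ : W ⟶ Y) (hφ : φ ≫ g = 0) :
    ∃ ψ : W ⟶ X, ψ ≫ f = φ :=
  (Triangle.coyoneda_exact₂ _ h φ hφ).imp fun _ h => h.symm

lemma tri_lift₃ (h : Triangle.mk f g k ∈ distTriang C) {W : C} (φ : W ⟶ Z) (hφ : φ ≫ k = 0) :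
    ∃ ψ : W ⟶ Y, ψ ≫ g = φ :=
  (Triangle.coyoneda_exact₃ _ h φ hφ).imp fun _ h => h.symm

lemma tri_of_iso (h : Triangle.mk f g k ∈ distTriang C) {X' Y' Z' : C} {f' : X' ⟶ Y'}
    {g' : Y' ⟶ Z'} {k' : Z' ⟶ X'⟦(1 : ℤ)⟧} (e₁ : X' ≅ X) (e₂ : Y' ≅ Y) (e₃ : Z' ≅ Z)
    (h₁ : f' ≫ e₂.hom = e₁.hom ≫ f) (h₂ : g' ≫ e₃.hom = e₂.hom ≫ g)
    (h₃ : k' ≫ e₁.hom⟦(1 : ℤ)⟧' = e₃.hom ≫ k) : Triangle.mk f' g' k' ∈ distTriang C :=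
  isomorphic_distinguished _ h _ (Triangle.isoMk _ _ e₁ e₂ e₃ h₁ h₂ h₃)

lemma tri_of_iso₂ (h : Triangle.mk f g k ∈ distTriang C) {Y' : C} (e : Y ≅ Y') :
    Triangle.mk (f ≫ e.hom) (e.inv ≫ g) k ∈ distTriang C :=
  tri_of_iso h (Iso.refl _) e.symm (Iso.refl _) (by simp) (by simp) (by simp)

lemma tri_shift (h : Triangle.mk f g k ∈ distTriang C) (n : ℤ) :
    Triangle.mk (n.negOnePow • f⟦n⟧') (n.negOnePow • g⟦n⟧')
      (n.negOnePow • k⟦n⟧' ≫ (shiftFunctorComm C 1 n).hom.app X) ∈ distTriang C :=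
  Triangle.shift_distinguished _ h n

lemma eq_zero_of_comp_tri (h : Triangle.mk f g k ∈ distTriang C) {W : C}
    (hW : ∀ ψ : W ⟶ Z⟦(-1 : ℤ)⟧, ψ = 0) (φ : W ⟶ X) (hφ : φ ≫ f = 0) : φ = 0 := by
  obtain ⟨ψ, hψ⟩ := tri_lift (inv_rot_of_distTriang _ h) φ hφ
  have h0 : ψ = 0 := hW ψ
  rw [h0, zero_comp] at hψ
  exact hψ.symm

/-- Morphisms `K ⟶ X⟦a⟧` come from morphisms `K⟦-a⟧ ⟶ X`. -/
lemma exists_shift_eq {K : C} (a : ℤ) (ψ : K ⟶ X⟦a⟧) :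
    ∃ φ : K⟦-a⟧ ⟶ X, φ⟦a⟧' = (shiftNegShift K a).hom ≫ ψ :=
  ⟨(shiftFunctor C a).preimage ((shiftNegShift K a).hom ≫ ψ),
    Functor.map_preimage _ _⟩

/-- If composition with `f` is injective on morphisms from `K⟦-a⟧`, then composition with `f⟦a⟧`
is injective on morphisms from `K`. -/
lemma eq_zero_of_comp_shift {K : C} (a : ℤ) (hf : ∀ φ : K⟦-a⟧ ⟶ X, φ ≫ f = 0 → φ = 0)
    (ψ : K ⟶ X⟦a⟧) (hψ : ψ ≫ f⟦a⟧' = 0) : ψ = 0 := by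
  obtain ⟨φ, hφ⟩ := exists_shift_eq a ψ
  have h0 : φ = 0 := by
    refine hf φ ((shiftFunctor C a).map_injective ?_)
    rw [Functor.map_comp, hφ, Category.assoc, hψ, comp_zero, Functor.map_zero]
  rw [← cancel_epi ((shiftNegShift K a).hom), ← hφ, h0, Functor.map_zero, comp_zero]

end Triangles

/-! ### Sequential homotopy colimits -/

section HomotopyColimits

open scoped Classical ZeroObject

variable {C : Type u} [Category.{v} C] [Preadditive C] [HasCoproducts.{v} C]

/-- The family of objects of a sequence, indexed by a type in the universe of the morphisms. -/
abbrev seqFamily (X : ℕ ⥤ C) : ULift.{v} ℕ → C := fun n => X.obj n.down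

/-- The transition map `X n ⟶ X (n + 1)` of a sequence. -/
abbrev transition (X : ℕ ⥤ C) (n : ℕ) : X.obj n ⟶ X.obj (n + 1) :=
  X.map (homOfLE (Nat.le_succ n))

/-- The endomorphism `1 - shift` of the coproduct of a sequence. -/
noncomputable def oneSubShift (X : ℕ ⥤ C) : ∐ seqFamily X ⟶ ∐ seqFamily X :=
  Sigma.desc fun n => Sigma.ι (seqFamily X) n -
    transition X n.down ≫ Sigma.ι (seqFamily X) ⟨n.down + 1⟩

lemma ι_oneSubShift (X : ℕ ⥤ C) (n : ℕ) :
    Sigma.ι (seqFamily X) ⟨n⟩ ≫ oneSubShift X = Sigma.ι (seqFamily X) ⟨n⟩ -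
      transition X n ≫ Sigma.ι (seqFamily X) ⟨n + 1⟩ := by
  simp [oneSubShift]

lemma oneSubShift_π_zero (X : ℕ ⥤ C) :
    oneSubShift X ≫ Sigma.π (seqFamily X) ⟨0⟩ = Sigma.π (seqFamily X) ⟨0⟩ := by
  refine Sigma.hom_ext _ _ fun ⟨n⟩ => ?_
  rw [← Category.assoc, ι_oneSubShift, Preadditive.sub_comp, Category.assoc,
    Sigma.ι_π_of_ne _ (by simp : (⟨n + 1⟩ : ULift ℕ) ≠ ⟨0⟩), comp_zero, sub_zero]

lemma oneSubShift_π_succ (X : ℕ ⥤ C) (n : ℕ) :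
    oneSubShift X ≫ Sigma.π (seqFamily X) ⟨n + 1⟩ =
      Sigma.π (seqFamily X) ⟨n + 1⟩ - Sigma.π (seqFamily X) ⟨n⟩ ≫ transition X n := by
  refine Sigma.hom_ext _ _ fun ⟨m⟩ => ?_
  rw [← Category.assoc, ι_oneSubShift, Preadditive.sub_comp, Preadditive.comp_sub, Category.assoc]
  congr 1
  by_cases h : m = n
  · subst h
    rw [Sigma.ι_π_eq_id, ← Category.assoc, Sigma.ι_π_eq_id, Category.comp_id, Category.id_comp]
  · rw [Sigma.ι_π_of_ne _ (by simpa using h : (⟨m + 1⟩ : ULift ℕ) ≠ ⟨n + 1⟩), comp_zero,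
      ← Category.assoc, Sigma.ι_π_of_ne _ (by simpa using h : (⟨m⟩ : ULift ℕ) ≠ ⟨n⟩), zero_comp]

/-- Composition with `1 - shift` is injective on morphisms with finite support. -/
lemma eq_zero_of_comp_oneSubShift {X : ℕ ⥤ C} {K : C} {h : K ⟶ ∐ seqFamily X}
    (hs : HasFiniteSupport h) (h0 : h ≫ oneSubShift X = 0) : h = 0 := by
  suffices H : ∀ n : ℕ, h ≫ Sigma.π (seqFamily X) ⟨n⟩ = 0 from
    hs.eq_zero fun ⟨n⟩ => by convert H n
  intro n
  induction n with
  | zero => rw [← oneSubShift_π_zero X, ← Category.assoc, h0, zero_comp]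
  | succ n ih =>
    have := h0 =≫ Sigma.π (seqFamily X) ⟨n + 1⟩
    rw [Category.assoc, oneSubShift_π_succ, zero_comp, Preadditive.comp_sub, ← Category.assoc h,
      ih, zero_comp, sub_zero] at this
    exact this

variable [HasZeroObject C] [HasShift C ℤ] [∀ n : ℤ, (shiftFunctor C n).Additive]
  [Pretriangulated C]

/-- `Y`, together with the maps `ι n : X n ⟶ Y`, is a homotopy colimit of the sequence `X`: it is
a cone of `1 - shift` on the coproduct of the `X n`. -/
structure IsHocolim (X : ℕ ⥤ C) (Y : C) (ι : ∀ n, X.obj n ⟶ Y) : Prop where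
  exists_triangle : ∃ (p : ∐ seqFamily X ⟶ Y) (c : Y ⟶ (∐ seqFamily X)⟦(1 : ℤ)⟧),
    Triangle.mk (oneSubShift X) p c ∈ distTriang C ∧ ∀ n, Sigma.ι (seqFamily X) ⟨n⟩ ≫ p = ι n

lemma exists_isHocolim (X : ℕ ⥤ C) : ∃ (Y : C) (ι : ∀ n, X.obj n ⟶ Y), IsHocolim X Y ι := by
  obtain ⟨Y, p, c, h⟩ := distinguished_cocone_triangle (oneSubShift X)
  exact ⟨Y, fun n => Sigma.ι (seqFamily X) ⟨n⟩ ≫ p, ⟨p, c, h, fun _ => rfl⟩⟩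

namespace IsHocolim

variable {X : ℕ ⥤ C} {Y : C} {ι : ∀ n, X.obj n ⟶ Y} (hY : IsHocolim X Y ι)
include hY

lemma transition_comp (n : ℕ) : transition X n ≫ ι (n + 1) = ι n := by
  obtain ⟨p, c, h, hp⟩ := hY
  have := Sigma.ι (seqFamily X) ⟨n⟩ ≫= tri_comp₁₂ h
  rw [← Category.assoc, ι_oneSubShift, Preadditive.sub_comp, Category.assoc, hp, hp, comp_zero,
    sub_eq_zero] at this
  exact this.symm

lemma map_comp {m n : ℕ} (h : m ≤ n) : X.map (homOfLE h) ≫ ι n = ι m := by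
  induction n, h using Nat.le_induction with
  | base => simp
  | succ n hn ih =>
    have : homOfLE (hn.trans (Nat.le_succ n)) = homOfLE hn ≫ homOfLE (Nat.le_succ n) := rfl
    rw [this, X.map_comp, Category.assoc, hY.transition_comp, ih]

/-- Compatible morphisms from the terms of a sequence extend to its homotopy colimit. -/
lemma exists_desc {Z : C} (e : ∀ n, X.obj n ⟶ Z) (he : ∀ n, transition X n ≫ e (n + 1) = e n) :
    ∃ f : Y ⟶ Z, ∀ n, ι n ≫ f = e n := by
  obtain ⟨p, c, h, hp⟩ := hY
  obtain ⟨f, hf⟩ := tri_desc h (Sigma.desc fun n => e n.down : ∐ seqFamily X ⟶ Z) (by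
    refine Sigma.hom_ext _ _ fun ⟨n⟩ => ?_
    rw [← Category.assoc, ι_oneSubShift, Preadditive.sub_comp, Category.assoc]
    simp [he])
  refine ⟨f, fun n => ?_⟩
  rw [← hp, Category.assoc, hf]
  simp

/-- Morphisms from a compact object to a homotopy colimit come from a finite stage. -/
lemma exists_lift {K : C} (hK : isCompact C K) (g : K ⟶ Y) :
    ∃ (n : ℕ) (g' : K ⟶ X.obj n), g' ≫ ι n = g := by
  have hι := @map_comp _ _ _ _ _ _ _ _ _ _ _ hY
  obtain ⟨p, c, h, hp⟩ := hY
  have hgc : g ≫ c = 0 := by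
    refine eq_zero_of_comp_shift (f := oneSubShift X) 1 (fun φ hφ => ?_) _
      (by rw [Category.assoc, tri_comp₃₁ h, comp_zero])
    exact eq_zero_of_comp_oneSubShift
      ((isCompact_iff _).1 ((isCompact C).le_shift (-1 : ℤ) _ hK) _ φ) hφ
  obtain ⟨k, hk⟩ := tri_lift₃ h g hgc
  obtain ⟨s, hs⟩ := (isCompact_iff K).1 hK _ k
  let N := s.sup ULift.down
  refine ⟨N, ∑ j ∈ s.attach, k ≫ Sigma.π (seqFamily X) j.1 ≫
    X.map (homOfLE (Finset.le_sup (f := ULift.down) j.2)), ?_⟩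
  rw [← hk]
  conv_rhs => rw [hs, ← Finset.sum_attach]
  rw [Preadditive.sum_comp, Preadditive.sum_comp]
  refine Finset.sum_congr rfl fun j _ => ?_
  simp only [Category.assoc]
  rw [hι, hp j.1.down]
  congr!

/-- If a morphism from a compact object to a term of a sequence vanishes in the homotopy colimit,
then it vanishes at a later stage. -/
lemma exists_map_eq_zero {K : C} (hK : isCompact C K) {n : ℕ} (k : K ⟶ X.obj n)
    (hk : k ≫ ι n = 0) : ∃ (m : ℕ) (h : n ≤ m), k ≫ X.map (homOfLE h) = 0 := by
  obtain ⟨p, c, h, hp⟩ := hY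
  obtain ⟨f, hf⟩ := tri_lift h (k ≫ Sigma.ι (seqFamily X) ⟨n⟩) (by rw [Category.assoc, hp, hk])
  replace hf := hf.symm
  have hlow : ∀ m < n, f ≫ Sigma.π (seqFamily X) ⟨m⟩ = 0 := by
    intro m
    induction m with
    | zero =>
      intro hm
      rw [← oneSubShift_π_zero, ← Category.assoc, ← hf, Category.assoc,
        Sigma.ι_π_of_ne _ (by simpa using hm.ne' : (⟨n⟩ : ULift ℕ) ≠ ⟨0⟩), comp_zero]
    | succ m ih =>
      intro hm
      have := hf =≫ Sigma.π (seqFamily X) ⟨m + 1⟩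
      rw [Category.assoc, Category.assoc, oneSubShift_π_succ, Preadditive.comp_sub,
        ← Category.assoc f, ih (by omega),
        Sigma.ι_π_of_ne _ (by simpa using hm.ne' : (⟨n⟩ : ULift ℕ) ≠ ⟨m + 1⟩), zero_comp,
        comp_zero, sub_zero] at this
      exact this.symm
  have hn : f ≫ Sigma.π (seqFamily X) ⟨n⟩ = k := by
    cases n with
    | zero =>
      rw [← oneSubShift_π_zero, ← Category.assoc, ← hf, Category.assoc, Sigma.ι_π_eq_id,
        Category.comp_id]
    | succ n =>
      have := hf =≫ Sigma.π (seqFamily X) ⟨n + 1⟩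
      rw [Category.assoc, Category.assoc, oneSubShift_π_succ, Preadditive.comp_sub,
        ← Category.assoc f, hlow n (by omega), Sigma.ι_π_eq_id, zero_comp, sub_zero,
        Category.comp_id] at this
      exact this.symm
  have hhigh : ∀ m (hm : n ≤ m), f ≫ Sigma.π (seqFamily X) ⟨m⟩ = k ≫ X.map (homOfLE hm) := by
    intro m hm
    induction m, hm using Nat.le_induction with
    | base => simp [hn]
    | succ m hm ih =>
      have := hf =≫ Sigma.π (seqFamily X) ⟨m + 1⟩
      rw [Category.assoc, Category.assoc, oneSubShift_π_succ, Preadditive.comp_sub,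
        ← Category.assoc f (Sigma.π (seqFamily X) ⟨m⟩), ih,
        Sigma.ι_π_of_ne _ (by simp; omega : (⟨n⟩ : ULift ℕ) ≠ ⟨m + 1⟩), comp_zero, eq_comm,
        sub_eq_zero] at this
      rw [this, Category.assoc, ← X.map_comp]
      rfl
  obtain ⟨s, hs⟩ := (isCompact_iff K).1 hK _ f
  let m := max n (s.sup ULift.down + 1)
  refine ⟨m, le_max_left _ _, ?_⟩
  rw [← hhigh m (le_max_left _ _)]
  suffices hm : (⟨m⟩ : ULift ℕ) ∉ s by convert HasFiniteSupport.comp_π_eq_zero hs hm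
  intro hm
  have h1 : m ≤ s.sup ULift.down := Finset.le_sup (f := ULift.down) hm
  have h2 : s.sup ULift.down + 1 ≤ m := le_max_right _ _
  omega

end IsHocolim

/-- A compact generator detects isomorphisms. -/
lemma IsCompactGenerator.isIso {G : C} (hG : IsCompactGenerator G) {X Y : C} (f : X ⟶ Y)
    (hinj : ∀ (i : ℤ) (g : G⟦i⟧ ⟶ X), g ≫ f = 0 → g = 0)
    (hsurj : ∀ (i : ℤ) (g : G⟦i⟧ ⟶ Y), ∃ g' : G⟦i⟧ ⟶ X, g' ≫ f = g) : IsIso f := by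
  obtain ⟨Z, p, c, h⟩ := distinguished_cocone_triangle f
  have hZ : IsZero Z := hG.isZero Z fun i g => by
    obtain ⟨k, hk⟩ := tri_lift₃ h g (by
      let e : G⟦i - 1⟧ ≅ (G⟦i⟧)⟦(-1 : ℤ)⟧ := (shiftFunctorAdd' C i (-1) (i - 1) (by omega)).app G
      refine eq_zero_of_comp_shift (f := f) 1 (fun φ hφ => ?_) _
        (by rw [Category.assoc, tri_comp₃₁ h, comp_zero])
      rw [← cancel_epi e.hom, hinj _ (e.hom ≫ φ) (by rw [Category.assoc, hφ, comp_zero]),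
        comp_zero])
    obtain ⟨g', hg'⟩ := hsurj i k
    rw [← hk, ← hg', Category.assoc, tri_comp₁₂ h, comp_zero]
  exact (Triangle.isZero₃_iff_isIso₁ _ h).1 hZ

/-- A sequence of objects over `F` has `F` as homotopy colimit, if the shifts of a compact
generator do not distinguish `F` from the colimit of the sequence. -/
lemma IsCompactGenerator.isHocolim {G : C} (hG : IsCompactGenerator G) (X : ℕ ⥤ C) {F : C}
    (e : ∀ n, X.obj n ⟶ F) (he : ∀ n, transition X n ≫ e (n + 1) = e n)
    (hsurj : ∀ (i : ℤ) (g : G⟦i⟧ ⟶ F), ∃ (n : ℕ) (g' : G⟦i⟧ ⟶ X.obj n), g' ≫ e n = g)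
    (hinj : ∀ (i : ℤ) (n : ℕ) (g : G⟦i⟧ ⟶ X.obj n), g ≫ e n = 0 →
      ∃ (m : ℕ) (h : n ≤ m), g ≫ X.map (homOfLE h) = 0) :
    IsHocolim X F e := by
  obtain ⟨Y, ι, hY⟩ := exists_isHocolim X
  obtain ⟨f, hf⟩ := hY.exists_desc e he
  have : IsIso f := by
    refine hG.isIso f (fun i g hg => ?_) (fun i g => ?_)
    · obtain ⟨n, g', rfl⟩ := hY.exists_lift ((ApproxTriang.isCompact C).le_shift i _ hG.isCompact) g
      rw [Category.assoc, hf] at hg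
      obtain ⟨m, hm, h0⟩ := hinj i n g' hg
      rw [← hY.map_comp hm, ← Category.assoc, h0, zero_comp]
    · obtain ⟨n, g', hg'⟩ := hsurj i g
      exact ⟨g' ≫ ι n, by rw [Category.assoc, hf, hg']⟩
  obtain ⟨p, c, h, hp⟩ := hY
  refine ⟨p ≫ f, inv f ≫ c, ?_, fun n => by rw [← Category.assoc, hp, hf]⟩
  exact tri_of_iso h (Iso.refl _) (Iso.refl _) (asIso f).symm (by simp) (by simp) (by simp)

end HomotopyColimits

/-! ### Compact objects are built from a compact generator -/

section Thick

open scoped Classical ZeroObject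

variable {C : Type u} [Category.{v} C]

/-- The morphism `f` factors through an object with the property `Q`. -/
def FactorsThrough (Q : ObjectProperty C) {K X : C} (f : K ⟶ X) : Prop :=
  ∃ (B : C) (a : K ⟶ B) (b : B ⟶ X), Q B ∧ a ≫ b = f

lemma FactorsThrough.comp {Q : ObjectProperty C} {K X Y : C} {f : K ⟶ X}
    (hf : FactorsThrough Q f) (g : X ⟶ Y) : FactorsThrough Q (f ≫ g) := by
  obtain ⟨B, a, b, hB, rfl⟩ := hf
  exact ⟨B, a, b ≫ g, hB, by simp⟩

variable [Preadditive C] [HasZeroObject C] [HasShift C ℤ] [∀ n : ℤ, (shiftFunctor C n).Additive]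
  [Pretriangulated C]

lemma FactorsThrough.zero (Q : ObjectProperty C) [Q.IsTriangulated]
    [Q.IsClosedUnderIsomorphisms] (K X : C) : FactorsThrough Q (0 : K ⟶ X) :=
  ⟨0, 0, 0, Q.prop_zero, by simp⟩

lemma FactorsThrough.add {Q : ObjectProperty C} [Q.IsTriangulated] [Q.IsClosedUnderIsomorphisms]
    {K X : C} {f g : K ⟶ X} (hf : FactorsThrough Q f) (hg : FactorsThrough Q g) :
    FactorsThrough Q (f + g) := by
  obtain ⟨B, a, b, hB, rfl⟩ := hf
  obtain ⟨B', a', b', hB', rfl⟩ := hg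
  exact ⟨B ⊞ B', biprod.lift a a', biprod.desc b b',
    Q.ext_of_isTriangulatedClosed₂ _ (binaryBiproductTriangle_distinguished B B') hB hB', by simp⟩

lemma FactorsThrough.sum {Q : ObjectProperty C} [Q.IsTriangulated] [Q.IsClosedUnderIsomorphisms]
    {K X : C} {J : Type*} (s : Finset J) (f : J → (K ⟶ X))
    (hf : ∀ j ∈ s, FactorsThrough Q (f j)) : FactorsThrough Q (∑ j ∈ s, f j) :=
  Finset.sum_induction f _ (fun _ _ => .add) (.zero Q K X) hf

lemma FactorsThrough.of_shift {Q : ObjectProperty C} [Q.IsTriangulated] {K X : C} (a : ℤ)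
    (h : ∀ φ : K⟦-a⟧ ⟶ X, FactorsThrough Q φ) (ψ : K ⟶ X⟦a⟧) : FactorsThrough Q ψ := by
  obtain ⟨φ, hφ⟩ := exists_shift_eq a ψ
  obtain ⟨B, u, v, hB, rfl⟩ := h φ
  refine ⟨B⟦a⟧, (shiftNegShift K a).inv ≫ u⟦a⟧', v⟦a⟧', Q.le_shift a _ hB, ?_⟩
  rw [Category.assoc, ← Functor.map_comp, hφ, Iso.inv_hom_id_assoc]

/-- If `f` followed by the second map of a triangle `A ⟶ X ⟶ X' ⟶ A⟦1⟧` factors through `Q`,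
then so does `f`, provided that morphisms from compact objects to `A` and `A⟦1⟧` factor
through `Q`. -/
lemma FactorsThrough.of_comp [HasCoproducts.{v} C] {Q : ObjectProperty C} [Q.IsTriangulated]
    [Q.IsClosedUnderIsomorphisms]
    (hQ : Q ≤ isCompact C) {A X X' : C} {a : A ⟶ X} {b : X ⟶ X'} {c : X' ⟶ A⟦(1 : ℤ)⟧}
    (h : Triangle.mk a b c ∈ distTriang C)
    (hA : ∀ {K : C} (φ : K ⟶ A), isCompact C K → FactorsThrough Q φ)
    {K : C} (hK : isCompact C K) (f : K ⟶ X) (hf : FactorsThrough Q (f ≫ b)) :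
    FactorsThrough Q f := by
  have hA1 : ∀ {K : C} (φ : K ⟶ A⟦(1 : ℤ)⟧), isCompact C K → FactorsThrough Q φ := fun φ hK =>
    .of_shift 1 (fun φ => hA φ ((isCompact C).le_shift _ _ hK)) φ
  obtain ⟨B, u, v, hB, huv⟩ := hf
  obtain ⟨D, p, q, hD, hpq⟩ := hA1 (v ≫ c) (hQ _ hB)
  -- enlarge `D` so that the morphism from `K` to it becomes zero
  obtain ⟨E, e, e', hE⟩ := distinguished_cocone_triangle (u ≫ p)
  obtain ⟨q', hq'⟩ := tri_desc hE q (by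
    rw [Category.assoc, hpq, ← Category.assoc, huv, Category.assoc, tri_comp₂₃ h, comp_zero])
  obtain ⟨D', r, s, hD', hrs⟩ := hA1 q'
    ((isCompact C).ext_of_isTriangulatedClosed₃ _ hE hK (hQ _ hD))
  obtain ⟨B', i, j, hB'⟩ := distinguished_cocone_triangle₁ (p ≫ e ≫ r)
  have hQB' : Q B' := Q.ext_of_isTriangulatedClosed₁ _ hB' hB hD'
  obtain ⟨u', hu'⟩ := tri_lift hB' u (by
    rw [← Category.assoc, ← Category.assoc, tri_comp₁₂ hE, zero_comp])
  obtain ⟨v', hv'⟩ := tri_lift₃ h (i ≫ v) (by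
    have : (p ≫ e ≫ r) ≫ s = v ≫ c := by simp only [Category.assoc]; rw [hrs, hq', hpq]
    rw [Category.assoc, ← this, ← Category.assoc, tri_comp₁₂ hB', zero_comp])
  obtain ⟨l, hl⟩ := tri_lift h (f - u' ≫ v') (by
    rw [Preadditive.sub_comp, Category.assoc, hv', ← Category.assoc, hu', huv, sub_self])
  have hf : f = u' ≫ v' + l ≫ a := by rw [hl]; abel
  rw [hf]
  exact .add ⟨B', u', v', hQB', rfl⟩ ((hA l hK).comp a)

variable [HasCoproducts.{v} C]

/-- A morphism from a compact object to a coproduct of objects of `Q` factors through `Q`. -/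
lemma FactorsThrough.of_coproduct {Q : ObjectProperty C} [Q.IsTriangulated]
    [Q.IsClosedUnderIsomorphisms] {J : Type v} (X : J → C) (hX : ∀ j, Q (X j)) {K : C}
    (φ : K ⟶ ∐ X) (hK : isCompact C K) : FactorsThrough Q φ := by
  obtain ⟨s, hs⟩ := (isCompact_iff K).1 hK X φ
  rw [hs]
  exact .sum s _ fun j _ => ⟨X j, φ ≫ Sigma.π X j, Sigma.ι X j, hX j, by simp⟩

/-- The coproduct of copies of the shifts of `G`, one for each morphism to `X`. -/
noncomputable abbrev adamsSource (G X : C) : C :=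
  ∐ fun p : (i : ULift.{v} ℤ) × (G⟦i.down⟧ ⟶ X) => G⟦p.1.down⟧

/-- The evaluation map of `adamsSource`. -/
noncomputable abbrev adamsEval (G X : C) : adamsSource G X ⟶ X :=
  Sigma.desc fun p => p.2

/-- The cone of the evaluation map: all morphisms from shifts of `G` to `X` vanish in it. -/
noncomputable def adamsCone (G X : C) : C :=
  (distinguished_cocone_triangle (adamsEval G X)).choose

/-- The map from `X` to the cone of the evaluation map. -/
noncomputable def toAdamsCone (G X : C) : X ⟶ adamsCone G X :=
  (distinguished_cocone_triangle (adamsEval G X)).choose_spec.choose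

lemma exists_adamsTriangle (G X : C) : ∃ c : adamsCone G X ⟶ (adamsSource G X)⟦(1 : ℤ)⟧,
    Triangle.mk (adamsEval G X) (toAdamsCone G X) c ∈ distTriang C :=
  (distinguished_cocone_triangle (adamsEval G X)).choose_spec.choose_spec

lemma comp_toAdamsCone (G X : C) {i : ℤ} (g : G⟦i⟧ ⟶ X) : g ≫ toAdamsCone G X = 0 := by
  obtain ⟨c, hc⟩ := exists_adamsTriangle G X
  have : g = Sigma.ι (fun p : (i : ULift.{v} ℤ) × (G⟦i.down⟧ ⟶ X) => G⟦p.1.down⟧) ⟨⟨i⟩, g⟩ ≫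
    adamsEval G X := by simp
  rw [this, Category.assoc, tri_comp₁₂ hc, comp_zero]

/-- The sequence of objects obtained from `X` by iterating `adamsCone`. -/
noncomputable def adamsObj (G X : C) : ℕ → C
  | 0 => X
  | n + 1 => adamsCone G (adamsObj G X n)

/-- The sequence of morphisms obtained from `X` by iterating `adamsCone`. -/
noncomputable def adamsSequence (G X : C) : ℕ ⥤ C :=
  Functor.ofSequence (X := adamsObj G X) fun n => toAdamsCone G (adamsObj G X n)

lemma exists_triangle_transition_adamsSequence (G X : C) (n : ℕ) :
    ∃ c : (adamsSequence G X).obj (n + 1) ⟶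
        (adamsSource G ((adamsSequence G X).obj n))⟦(1 : ℤ)⟧,
      Triangle.mk (adamsEval G ((adamsSequence G X).obj n)) (transition (adamsSequence G X) n) c ∈
        distTriang C := by
  rw [show transition (adamsSequence G X) n = toAdamsCone G (adamsObj G X n) from
    Functor.ofSequence_map_homOfLE_succ _ _]
  exact exists_adamsTriangle G (adamsObj G X n)

lemma comp_transition_adamsSequence (G X : C) (n : ℕ) {i : ℤ}
    (g : G⟦i⟧ ⟶ (adamsSequence G X).obj n) : g ≫ transition (adamsSequence G X) n = 0 := by
  rw [show transition (adamsSequence G X) n = toAdamsCone G (adamsObj G X n) from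
    Functor.ofSequence_map_homOfLE_succ _ _]
  exact comp_toAdamsCone G (adamsObj G X n) g

/-- The homotopy colimit of the sequence `adamsSequence G X` vanishes, so that every morphism
from a compact object to `X` vanishes at a finite stage. -/
lemma exists_comp_adamsSequence_eq_zero {G : C} (hG : IsCompactGenerator G) {K X : C}
    (hK : isCompact C K) (f : K ⟶ (adamsSequence G X).obj 0) :
    ∃ n : ℕ, f ≫ (adamsSequence G X).map (homOfLE (Nat.zero_le n)) = 0 := by
  obtain ⟨Y, ι, hY⟩ := exists_isHocolim (adamsSequence G X)
  have hY0 : IsZero Y := hG.isZero Y fun i g => by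
    obtain ⟨n, g', rfl⟩ := hY.exists_lift ((isCompact C).le_shift i _ hG.isCompact) g
    rw [← hY.transition_comp, ← Category.assoc, comp_transition_adamsSequence, zero_comp]
  obtain ⟨m, h, hm⟩ := hY.exists_map_eq_zero hK f (hY0.eq_of_tgt _ _)
  exact ⟨m, hm⟩

/-- Every morphism from a compact object factors through a compact object which lies in a given
thick subcategory containing a compact generator. -/
lemma factorsThrough_of_isCompactGenerator {G : C} (hG : IsCompactGenerator G)
    (Q : ObjectProperty C) [Q.IsTriangulated] [Q.IsClosedUnderIsomorphisms]
    (hQ : Q ≤ isCompact C) (hQG : Q G) {K X : C} (hK : isCompact C K) (f : K ⟶ X) :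
    FactorsThrough Q f := by
  have key : ∀ (n : ℕ) (f : K ⟶ (adamsSequence G X).obj 0), FactorsThrough Q
      (f ≫ (adamsSequence G X).map (homOfLE (Nat.zero_le n))) → FactorsThrough Q f := by
    intro n f
    induction n with
    | zero =>
      intro h
      have : (adamsSequence G X).map (homOfLE (Nat.zero_le 0)) = 𝟙 _ :=
        (adamsSequence G X).map_id 0
      rw [this, Category.comp_id] at h
      exact h
    | succ n ih =>
      intro h
      refine ih ?_
      have hmap : (adamsSequence G X).map (homOfLE (Nat.zero_le (n + 1))) =
          (adamsSequence G X).map (homOfLE (Nat.zero_le n)) ≫ transition (adamsSequence G X) n := by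
        rw [← Functor.map_comp]
        rfl
      rw [hmap, ← Category.assoc] at h
      obtain ⟨c, hc⟩ := exists_triangle_transition_adamsSequence G X n
      exact .of_comp hQ hc (fun φ hK => .of_coproduct (Q := Q)
        (fun p : (i : ULift.{v} ℤ) × (G⟦i.down⟧ ⟶ (adamsSequence G X).obj n) => G⟦p.1.down⟧)
        (fun p => Q.le_shift p.1.down _ hQG) φ hK) hK _ h
  obtain ⟨n, hn⟩ := exists_comp_adamsSequence_eq_zero (X := X) hG hK f
  exact key n f (hn ▸ .zero Q _ _)

/-- A thick subcategory which contains a compact generator contains all compact objects. -/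
theorem IsCompactGenerator.isCompact_le {G : C} (hG : IsCompactGenerator G)
    (P : ObjectProperty C) [P.IsTriangulated] [P.IsStableUnderRetracts] (hP : P G) :
    ApproxTriang.isCompact C ≤ P := by
  intro K hK
  obtain ⟨B, a, b, hB, hab⟩ := factorsThrough_of_isCompactGenerator hG
    (P ⊓ ApproxTriang.isCompact C) inf_le_right ⟨hP, hG.isCompact⟩ hK (𝟙 K)
  exact P.prop_of_retract ⟨a, b, hab⟩ hB.1

end Thick

/-! ### Morphisms with a prescribed fibre -/

section Fibres

open scoped ZeroObject

variable {C : Type u} [Category.{v} C] [Preadditive C] [HasZeroObject C] [HasShift C ℤ]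
  [∀ n : ℤ, (shiftFunctor C n).Additive] [Pretriangulated C]

/-- The morphism `f` has a fibre with the property `Q`. -/
def HasFibreIn (Q : ObjectProperty C) {X Y : C} (f : X ⟶ Y) : Prop :=
  ∃ (P : C) (a : P ⟶ X) (c : Y ⟶ P⟦(1 : ℤ)⟧), Triangle.mk a f c ∈ distTriang C ∧ Q P

lemma HasFibreIn.mono {Q Q' : ObjectProperty C} (h : Q ≤ Q') {X Y : C} {f : X ⟶ Y}
    (hf : HasFibreIn Q f) : HasFibreIn Q' f := by
  obtain ⟨P, a, c, hT, hP⟩ := hf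
  exact ⟨P, a, c, hT, h _ hP⟩

lemma HasFibreIn.id {Q : ObjectProperty C} (hQ : Q 0) (X : C) : HasFibreIn Q (𝟙 X) :=
  ⟨0, 0, 0, contractible_distinguished₁ X, hQ⟩

/-- By the octahedral axiom, the fibre of a composition is an extension of the fibres. -/
lemma HasFibreIn.comp [IsTriangulated C] {Q : ObjectProperty C}
    (hQ : ∀ T ∈ distTriang C, Q T.obj₁ → Q T.obj₃ → Q T.obj₂) {X Y Z : C} {f : X ⟶ Y} {g : Y ⟶ Z}
    (hf : HasFibreIn Q f) (hg : HasFibreIn Q g) : HasFibreIn Q (f ≫ g) := by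
  obtain ⟨P, a, c, hT, hP⟩ := hf
  obtain ⟨P', a', c', hT', hP'⟩ := hg
  obtain ⟨P'', a'', c'', hT''⟩ := distinguished_cocone_triangle₁ (f ≫ g)
  exact ⟨P'', a'', c'', hT'', hQ _ (someOctahedron' rfl hT hT' hT'').mem hP hP'⟩

end Fibres

/-! ### Aisles of t-structures -/

section Aisles

open scoped ZeroObject

variable {C : Type u} [Category.{v} C] [Preadditive C] [HasZeroObject C] [HasShift C ℤ]
  [∀ n : ℤ, (shiftFunctor C n).Additive] [Pretriangulated C]

lemma le_iff_hom_eq_zero (t : TStructure C) (n : ℤ) (X : C) :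
    t.le n X ↔ ∀ (Y : C) (f : X ⟶ Y), t.ge (n + 1) Y → f = 0 := by
  rw [t.le_iff_isLE, t.isLE_iff_orthogonal n (n + 1) rfl]
  simp only [t.ge_iff_isGE]

lemma ge_iff_hom_eq_zero (t : TStructure C) (n : ℤ) (X : C) :
    t.ge (n + 1) X ↔ ∀ (Y : C) (f : Y ⟶ X), t.le n Y → f = 0 := by
  rw [t.ge_iff_isGE, t.isGE_iff_orthogonal n (n + 1) rfl]
  simp only [t.le_iff_isLE]

lemma hom_eq_zero (t : TStructure C) {m n : ℤ} (h : m < n) {X Y : C} (hX : t.le m X)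
    (hY : t.ge n Y) (f : X ⟶ Y) : f = 0 :=
  (le_iff_hom_eq_zero t m X).1 hX Y f (t.ge_antitone (by omega) Y hY)

lemma le_ext (t : TStructure C) (n : ℤ) (T : Triangle C) (hT : T ∈ distTriang C)
    (h₁ : t.le n T.obj₁) (h₃ : t.le n T.obj₃) : t.le n T.obj₂ :=
  (t.isLE₂ T hT n ⟨h₁⟩ ⟨h₃⟩).le

instance (t : TStructure C) (n : ℤ) : (t.le n).IsStableUnderRetracts where
  of_retract {X Y} r hY := by
    rw [le_iff_hom_eq_zero] at hY ⊢
    intro Z f hZ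
    have h : r.r ≫ f = 0 := hY Z _ hZ
    rw [← Category.id_comp f, ← r.retract, Category.assoc, h, comp_zero]

lemma le_zero_obj (t : TStructure C) (n : ℤ) : t.le n (0 : C) :=
  (le_iff_hom_eq_zero t n 0).2 fun _ _ _ => (isZero_zero C).eq_of_src _ _

lemma le_of_isColimit (t : TStructure C) (n : ℤ) {J : Type*} {F : J → C}
    (hF : ∀ j, t.le n (F j)) (c : Cofan F) (hc : IsColimit c) : t.le n c.pt := by
  rw [le_iff_hom_eq_zero]
  intro Y f hY
  refine Cofan.IsColimit.hom_ext hc _ _ fun j => ?_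
  rw [comp_zero]
  exact (le_iff_hom_eq_zero t n (F j)).1 (hF j) Y (c.inj j ≫ f) hY

/-- The objects without nonzero morphisms to objects of `𝒯^{≤ m}`. -/
def leOrthogonal (t : TStructure C) (m : ℤ) : ObjectProperty C := fun K =>
  ∀ Y : C, t.le m Y → ∀ f : K ⟶ Y, f = 0

lemma leOrthogonal_antitone (t : TStructure C) {m n : ℤ} (h : m ≤ n) :
    leOrthogonal t n ≤ leOrthogonal t m :=
  fun _ hK Y hY => hK Y (t.le_monotone h Y hY)

lemma leOrthogonal_ext (t : TStructure C) (m : ℤ) (T : Triangle C) (hT : T ∈ distTriang C)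
    (h₁ : leOrthogonal t m T.obj₁) (h₃ : leOrthogonal t m T.obj₃) : leOrthogonal t m T.obj₂ := by
  intro Y hY f
  obtain ⟨g, hg⟩ := T.yoneda_exact₂ hT f (h₁ Y hY _)
  rw [hg, h₃ Y hY g, comp_zero]

instance (t : TStructure C) (m : ℤ) : (leOrthogonal t m).IsStableUnderRetracts where
  of_retract {X Y} r hY Z hZ f := by
    have h : r.r ≫ f = 0 := hY Z hZ _
    rw [← Category.id_comp f, ← r.retract, Category.assoc, h, comp_zero]

lemma leOrthogonal_zero_obj (t : TStructure C) (m : ℤ) : leOrthogonal t m (0 : C) :=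
  fun _ _ _ => (isZero_zero C).eq_of_src _ _

lemma leOrthogonal_shift (t : TStructure C) {m i m' : ℤ} (h : i + m' = m) {K : C}
    (hK : leOrthogonal t m K) : leOrthogonal t m' (K⟦i⟧) := by
  intro Y hY f
  have hY' : t.le m (Y⟦-i⟧) := t.le_shift m' (-i) m (by omega) Y hY
  apply (shiftFunctor C (-i)).map_injective
  rw [Functor.map_zero, ← cancel_epi (shiftShiftNeg K i).inv, comp_zero]
  exact hK _ hY' _

/-- `X⟦i⟧` lies in `𝒯^{≤ m'}` if `X` lies in `𝒯^{≤ m}` for some `m ≤ i + m'`. -/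
lemma le_shift' (t : TStructure C) {m i m' : ℤ} (h : m ≤ i + m') {X : C} (hX : t.le m X) :
    t.le m' (X⟦i⟧) :=
  t.le_shift (i + m') i m' rfl X (t.le_monotone h X hX)

lemma leOrthogonal_shift' (t : TStructure C) {m i m' : ℤ} (h : i + m' ≤ m) {X : C}
    (hX : leOrthogonal t m X) : leOrthogonal t m' (X⟦i⟧) :=
  leOrthogonal_shift t rfl (leOrthogonal_antitone t h _ hX)

lemma le_of_shift (t : TStructure C) {m i n : ℤ} {X : C} (hX : t.le m (X⟦i⟧)) (h : i + m ≤ n) :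
    t.le n X :=
  (t.le n).prop_of_iso (shiftShiftNeg X i) (le_shift' t (by omega) hX)

lemma leOrthogonal_of_shift (t : TStructure C) {m i n : ℤ} {X : C}
    (hX : leOrthogonal t m (X⟦i⟧)) (h : n ≤ i + m) : leOrthogonal t n X :=
  (leOrthogonal t n).prop_of_iso (shiftShiftNeg X i) (leOrthogonal_shift' t (by omega) hX)

end Aisles

/-! ### Aisles generated by an object -/

section GeneratedAisles

open scoped ZeroObject

variable {C : Type u} [Category.{v} C] [Preadditive C] [HasZeroObject C] [HasShift C ℤ]
  [∀ n : ℤ, (shiftFunctor C n).Additive] [Pretriangulated C]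

lemma coprodClosure_addClosure (G : C) (S : Set ℤ) {X : C}
    (hX : addClosure (shiftsIn G S) X) : coprodClosure G S X := by
  obtain ⟨J, ⟨h⟩⟩ := hX
  let F : J → C := fun j => h.diag.obj ⟨j⟩
  let c : Cofan F := Cofan.mk X fun j => h.ι.app ⟨j⟩
  have hc : IsColimit c := Cofan.IsColimit.mk _
    (fun s => h.isColimit.desc (Cocone.mk s.pt (Discrete.natTrans fun j => s.inj j.as)))
    (fun s j => h.isColimit.fac _ _)
    (fun s m hm => h.isColimit.hom_ext fun ⟨j⟩ => by
      rw [h.isColimit.fac]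
      exact hm j)
  exact coprodClosure.coproduct F (fun j => .of _ (h.prop_diag_obj ⟨j⟩)) c hc

lemma coprodN_le_coprodClosure (G : C) (S : Set ℤ) (n : ℕ) :
    coprodN G S n ≤ coprodClosure G S := by
  induction n using coprodN.induct with
  | case1 => exact fun X hX => coprodClosure_addClosure G S hX
  | case2 => exact fun X hX => coprodClosure_addClosure G S hX
  | case3 n ih =>
    rintro X ⟨Y, Z, f, g, h, hT, hY, hZ⟩
    exact .ext _ hT (coprodClosure_addClosure G S hY) (ih _ hZ)

lemma coprodClosure_mono (G : C) {S S' : Set ℤ} (h : S ⊆ S') :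
    coprodClosure G S ≤ coprodClosure G S' := by
  intro X hX
  induction hX with
  | of X hX =>
    obtain ⟨i, hi, e⟩ := hX
    exact .of _ ⟨i, h hi, e⟩
  | coproduct F _ c hc ih => exact .coproduct F ih c hc
  | ext T hT _ _ ih₁ ih₃ => exact .ext T hT ih₁ ih₃

lemma coprodClosure_shift (G : C) {S S' : Set ℤ} (k : ℤ) (h : ∀ i ∈ S, i - k ∈ S') {X : C}
    (hX : coprodClosure G S X) : (coprodClosure G S') (X⟦k⟧) := by
  induction hX with
  | of X hX =>
    obtain ⟨i, hi, ⟨e⟩⟩ := hX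
    exact .of _ ⟨i - k, h i hi, ⟨(shiftFunctor C k).mapIso e ≪≫
      (shiftFunctorAdd' C (-i) k (-(i - k)) (by omega)).symm.app G⟩⟩
  | coproduct F _ c hc ih =>
    exact .coproduct (fun j => (F j)⟦k⟧) ih
      (Cofan.mk (c.pt⟦k⟧) fun j => (shiftFunctor C k).map (c.inj j))
      (isColimitCofanMkObjOfIsColimit (shiftFunctor C k) F c.inj hc)
  | ext T hT _ _ ih₁ ih₃ => exact .ext _ (Triangle.shift_distinguished T hT k) ih₁ ih₃

lemma aisle_of_shift_le (G : C) {i n : ℤ} (h : i ≤ n) : aisle G n (G⟦-i⟧) :=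
  ObjectProperty.le_retractClosure _ _ (.of _ ⟨i, h, ⟨Iso.refl _⟩⟩)

lemma aisle_shift (G : C) {m n k : ℤ} (h : m ≤ n + k) {X : C} (hX : aisle G m X) :
    aisle G n (X⟦k⟧) := by
  obtain ⟨Y, hY, ⟨r⟩⟩ := hX
  exact ⟨Y⟦k⟧, coprodClosure_shift G k (fun i (hi : i ≤ m) => by
    simp only [Set.mem_Iic]; omega) hY, ⟨r.map _⟩⟩

lemma aisle_ext (G : C) (n : ℤ) (T : Triangle C) (hT : T ∈ distTriang C) (h₁ : aisle G n T.obj₁)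
    (h₃ : aisle G n T.obj₃) : aisle G n T.obj₂ := by
  have hle : ObjectProperty.extensionProduct (coprodClosure G (Set.Iic n))
      (coprodClosure G (Set.Iic n)) ≤ coprodClosure G (Set.Iic n) := by
    rintro X ⟨Y, Z, f, g, h, hT, hY, hZ⟩
    exact .ext _ hT hY hZ
  exact ObjectProperty.monotone_retractClosure hle _
    (ObjectProperty.extensionProduct_retractClosure_retractClosure_le _ _ _
      ⟨_, _, T.mor₁, T.mor₂, T.mor₃, hT, h₁, h₃⟩)

lemma aisle_coproduct [HasCoproducts.{v} C] (G : C) (n : ℤ) {J : Type v} (X : J → C)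
    (hX : ∀ j, aisle G n (X j)) : aisle G n (∐ X) := by
  choose Y hY r using hX
  let r' := fun j => (r j).some
  refine ⟨∐ Y, .coproduct Y hY _ (coproductIsCoproduct Y), ⟨⟨Limits.Sigma.map fun j => (r' j).i,
    Limits.Sigma.map fun j => (r' j).r, ?_⟩⟩⟩
  refine Sigma.hom_ext _ _ fun j => ?_
  simp

lemma aisle_isHocolim [HasCoproducts.{v} C] (G : C) (n : ℤ) {X : ℕ ⥤ C} {Y : C}
    {ι : ∀ n, X.obj n ⟶ Y} (hY : IsHocolim X Y ι) (hX : ∀ j, aisle G n (X.obj j)) :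
    aisle G n Y := by
  obtain ⟨p, c, h, -⟩ := hY
  have hX' := aisle_coproduct G n (seqFamily X) fun j => hX j.down
  exact aisle_ext G n _ (tri_rot h) hX' (aisle_shift G (by omega) hX')

lemma aisle_zero_obj [HasCoproducts.{v} C] (G : C) (n : ℤ) : aisle G n (0 : C) :=
  ⟨_, .of _ ⟨n, Set.mem_Iic.2 le_rfl, ⟨Iso.refl _⟩⟩, ⟨⟨0, 0, by simp⟩⟩⟩

/-- The aisle generated by `G` is contained in every aisle which contains `G`. -/
lemma aisle_le (t : TStructure C) {G : C} {m n N : ℤ} (hG : t.le m G) (h : n + m ≤ N) :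
    aisle G n ≤ t.le N := by
  refine (ObjectProperty.retractClosure_le_iff _ _).2 fun X hX => ?_
  induction hX with
  | of X hX =>
    obtain ⟨i, hi, ⟨e⟩⟩ := hX
    have hi : i ≤ n := hi
    exact (t.le N).prop_of_iso e.symm (le_shift' t (by omega) hG)
  | coproduct F _ c hc ih => exact le_of_isColimit t N ih c hc
  | ext T hT _ _ ih₁ ih₃ => exact le_ext t N T hT ih₁ ih₃

end GeneratedAisles

/-! ### Approximability -/

section Approximability

open scoped ZeroObject

variable {C : Type u} [Category.{v} C] [Preadditive C] [HasZeroObject C] [HasShift C ℤ]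
  [∀ n : ℤ, (shiftFunctor C n).Additive] [Pretriangulated C]

/-- The compact generator `G`, the t-structure `t` and the integer `A` witness that the category is
approximable. -/
structure ApproxData (G : C) (t : TStructure C) (A : ℕ) : Prop where
  isCompactGenerator : IsCompactGenerator G
  pos : 0 < A
  le_shift : t.le 0 (G⟦(A : ℤ)⟧)
  leOrthogonal_shift : leOrthogonal t 0 (G⟦-(A : ℤ)⟧)
  exists_triangle_zero : ∀ F : C, t.le 0 F →
    ∃ (E D : C) (a : E ⟶ F) (b : F ⟶ D) (c : D ⟶ E⟦(1 : ℤ)⟧),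
      Triangle.mk a b c ∈ distTriang C ∧
      (coprodN G (Set.Icc (-(A : ℤ)) A) A).retractClosure E ∧ t.le (-1) D

lemma IsApproximable.exists_approxData (h : IsApproximable C) :
    ∃ (G : C) (t : TStructure C) (A : ℕ), ApproxData G t A := by
  obtain ⟨G, t, A, h₁, h₂, h₃, h₄, h₅⟩ := h
  exact ⟨G, t, A, h₁, h₂, h₃, h₄, h₅⟩

lemma addClosure_shift (G : C) {S S' : Set ℤ} (k : ℤ) (h : ∀ i ∈ S, i - k ∈ S') {X : C}
    (hX : addClosure (shiftsIn G S) X) : addClosure (shiftsIn G S') (X⟦k⟧) := by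
  obtain ⟨J, ⟨p⟩⟩ := hX
  refine ⟨J, ⟨{ p.toColimitPresentation.map (shiftFunctor C k) with
    prop_diag_obj := fun j => ?_ }⟩⟩
  obtain ⟨i, hi, ⟨e⟩⟩ := p.prop_diag_obj j
  exact ⟨i - k, h i hi, ⟨(shiftFunctor C k).mapIso e ≪≫
      (shiftFunctorAdd' C (-i) k (-(i - k)) (by omega)).symm.app G⟩⟩

lemma coprodN_shift (G : C) {S S' : Set ℤ} (k : ℤ) (h : ∀ i ∈ S, i - k ∈ S') (n : ℕ) {X : C}
    (hX : coprodN G S n X) : coprodN G S' n (X⟦k⟧) := by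
  induction n using coprodN.induct generalizing X with
  | case1 => exact addClosure_shift G k h hX
  | case2 => exact addClosure_shift G k h hX
  | case3 n ih =>
    obtain ⟨Y, Z, f, g, c, hT, hY, hZ⟩ := hX
    exact ⟨_, _, _, _, _, Triangle.shift_distinguished _ hT k, addClosure_shift G k h hY, ih hZ⟩

/-- `f` is a ghost for `G(S)`: composition with `f` kills all morphisms from the objects `Σ⁻ⁱ G`
with `i ∈ S`. -/
def IsGhost (G : C) (S : Set ℤ) {X Y : C} (f : X ⟶ Y) : Prop :=
  ∀ i ∈ S, ∀ g : G⟦-i⟧ ⟶ X, g ≫ f = 0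

/-- `f` is a composition of `n` ghosts for `G(S)`. -/
inductive IsGhostComp (G : C) (S : Set ℤ) : ℕ → ∀ {X Y : C}, (X ⟶ Y) → Prop
  | id (X : C) : IsGhostComp G S 0 (𝟙 X)
  | comp {n : ℕ} {X Y Z : C} {f : X ⟶ Y} {g : Y ⟶ Z} (hf : IsGhost G S f)
      (hg : IsGhostComp G S n g) : IsGhostComp G S (n + 1) (f ≫ g)

lemma comp_eq_zero_of_addClosure {G : C} {S : Set ℤ} {E X Y : C}
    (hE : addClosure (shiftsIn G S) E) (g : E ⟶ X) {f : X ⟶ Y} (hf : IsGhost G S f) :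
    g ≫ f = 0 := by
  obtain ⟨J, ⟨p⟩⟩ := hE
  refine p.isColimit.hom_ext fun j => ?_
  obtain ⟨i, hi, ⟨e⟩⟩ := p.prop_diag_obj j
  have h : (e.inv ≫ p.ι.app j ≫ g) ≫ f = 0 := hf i hi _
  rw [Category.assoc, Preadditive.IsIso.comp_left_eq_zero, Category.assoc] at h
  rw [comp_zero]
  exact h

/-- The ghost lemma. -/
lemma comp_eq_zero_of_coprodN {G : C} {S : Set ℤ} {n : ℕ} {E X Y : C}
    (hE : coprodN G S (n + 1) E) (g : E ⟶ X) {f : X ⟶ Y} (hf : IsGhostComp G S (n + 1) f) :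
    g ≫ f = 0 := by
  induction n generalizing E X with
  | zero =>
    cases hf with | comp hf _ =>
    rw [← Category.assoc, comp_eq_zero_of_addClosure hE g hf, zero_comp]
  | succ n ih =>
    cases hf with | comp hf hf' =>
    obtain ⟨E₁, E₂, a, b, c, hT, h₁, h₂⟩ := hE
    rename_i Z f f'
    obtain ⟨k, hk⟩ := tri_desc hT (g ≫ f) (by
      rw [← Category.assoc, comp_eq_zero_of_addClosure h₁ (a ≫ g) hf])
    rw [← Category.assoc, ← hk, Category.assoc, ih h₂ k hf', comp_zero]

lemma comp_eq_zero_of_retractClosure_coprodN {G : C} {S : Set ℤ} {n : ℕ} (hn : 0 < n) {E X Y : C}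
    (hE : (coprodN G S n).retractClosure E) (g : E ⟶ X) {f : X ⟶ Y} (hf : IsGhostComp G S n f) :
    g ≫ f = 0 := by
  obtain ⟨n, rfl⟩ : ∃ m, n = m + 1 := ⟨n - 1, by omega⟩
  obtain ⟨E', hE', ⟨r⟩⟩ := hE
  rw [← Category.id_comp g, ← r.retract, Category.assoc, Category.assoc, ← Category.assoc r.r,
    comp_eq_zero_of_coprodN hE' _ hf, comp_zero]

lemma comp_eq_zero_of_coprodClosure {G : C} {S : Set ℤ} {Y E : C}
    (hS : ∀ i ∈ S, ∀ f : G⟦-i⟧ ⟶ Y, f = 0) (hE : coprodClosure G S E) (g : E ⟶ Y) : g = 0 := by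
  induction hE with
  | of X hX =>
    obtain ⟨i, hi, ⟨e⟩⟩ := hX
    rw [← cancel_epi e.inv, comp_zero]
    exact hS i hi _
  | coproduct F _ c hc ih =>
    exact Cofan.IsColimit.hom_ext hc _ _ fun j => by
      rw [comp_zero]
      exact ih j _
  | ext T hT _ _ ih₁ ih₃ =>
    obtain ⟨k, hk⟩ := T.yoneda_exact₂ hT g (ih₁ _)
    rw [hk, ih₃ k, comp_zero]

lemma comp_eq_zero_of_retractClosure_coprodClosure {G : C} {S : Set ℤ} {Y E : C}
    (hS : ∀ i ∈ S, ∀ f : G⟦-i⟧ ⟶ Y, f = 0) (hE : (coprodClosure G S).retractClosure E)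
    (g : E ⟶ Y) : g = 0 := by
  obtain ⟨E', hE', ⟨r⟩⟩ := hE
  rw [← Category.id_comp g, ← r.retract, Category.assoc,
    comp_eq_zero_of_coprodClosure hS hE' (r.r ≫ g), comp_zero]

namespace ApproxData

variable {G : C} {t : TStructure C} {A : ℕ} (d : ApproxData G t A)
include d

lemma le_obj : t.le A G := le_of_shift t d.le_shift (by omega)

lemma leOrthogonal_obj : leOrthogonal t (-A) G :=
  leOrthogonal_of_shift t d.leOrthogonal_shift (by omega)

lemma exists_triangle (N : ℤ) {F : C} (hF : t.le N F) :
    ∃ (E D : C) (a : E ⟶ F) (b : F ⟶ D) (c : D ⟶ E⟦(1 : ℤ)⟧),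
      Triangle.mk a b c ∈ distTriang C ∧
      (coprodN G (Set.Icc (N - A) (N + A)) A).retractClosure E ∧ t.le (N - 1) D := by
  obtain ⟨E, D, a, b, c, hT, ⟨E', hE', ⟨r⟩⟩, hD⟩ :=
    d.exists_triangle_zero (F⟦N⟧) (le_shift' t (by omega) hF)
  exact ⟨E⟦-N⟧, D⟦-N⟧, _, _, _, tri_of_iso₂ (tri_shift hT (-N)) (shiftShiftNeg F N),
    ⟨E'⟦-N⟧, coprodN_shift G (-N) (fun i hi => by simp only [Set.mem_Icc] at hi ⊢; omega) A hE',
      ⟨r.map _⟩⟩, le_shift' t (by omega) hD⟩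

/-- Every object `F` of `𝒯^{≤ N}` has a morphism `b` to an object of `𝒯^{≤ N - 1}` such that
composition with `A` ghosts turns every morphism from `F` into one which factors through `b`. -/
lemma exists_factor (N : ℤ) {F : C} (hF : t.le N F) :
    ∃ (D : C) (b : F ⟶ D), t.le (N - 1) D ∧ ∀ {X Y : C} (g : F ⟶ X) (f : X ⟶ Y),
      IsGhostComp G (Set.Icc (N - A) (N + A)) A f → ∃ h : D ⟶ Y, b ≫ h = g ≫ f := by
  obtain ⟨E, D, a, b, c, hT, hE, hD⟩ := d.exists_triangle N hF
  refine ⟨D, b, hD, fun g f hf => tri_desc hT _ ?_⟩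
  rw [← Category.assoc]
  exact comp_eq_zero_of_retractClosure_coprodN d.pos hE _ hf

end ApproxData

end Approximability

/-! ### Objects approximated by the terms of a sequence -/

section Sequences

variable {C : Type u} [Category.{v} C] [Preadditive C] [HasZeroObject C] [HasShift C ℤ]
  [∀ n : ℤ, (shiftFunctor C n).Additive] [Pretriangulated C]

/-- An approximation of `F`, with error in `𝒯^{≤ -n}`, by an object with the property `Q`. -/
structure Approximation (t : TStructure C) (Q : ObjectProperty C) (F : C) (n : ℕ) where
  /-- the approximating object -/
  obj : C
  /-- the morphism to the approximated object -/
  hom : obj ⟶ F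
  prop_obj : Q obj
  exists_triangle : ∃ (D : C) (b : F ⟶ D) (c : D ⟶ obj⟦(1 : ℤ)⟧),
    Triangle.mk hom b c ∈ distTriang C ∧ t.le (-n) D

variable [HasCoproducts.{v} C]

/-- If a compatible sequence of objects approximates `F` with smaller and smaller error, then
`F` is its homotopy colimit. -/
lemma isHocolim_of_triangles {G : C} (hG : IsCompactGenerator G) {t : TStructure C} {B : ℤ}
    (hB : leOrthogonal t B G) (X : ℕ ⥤ C) {F : C} (e : ∀ n, X.obj n ⟶ F)
    (he : ∀ n, transition X n ≫ e (n + 1) = e n)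
    (hD : ∀ n : ℕ, ∃ (D : C) (b : F ⟶ D) (c : D ⟶ (X.obj n)⟦(1 : ℤ)⟧),
      Triangle.mk (e n) b c ∈ distTriang C ∧ t.le (-n) D) : IsHocolim X F e := by
  have he' : ∀ {m n : ℕ} (h : m ≤ n), X.map (homOfLE h) ≫ e n = e m := by
    intro m n h
    induction n, h using Nat.le_induction with
    | base => simp
    | succ n hn ih =>
      have : homOfLE (hn.trans (Nat.le_succ n)) = homOfLE hn ≫ homOfLE (Nat.le_succ n) := rfl
      rw [this, X.map_comp, Category.assoc, he, ih]
  have hi (i : ℤ) : leOrthogonal t (B - i) (G⟦i⟧) := leOrthogonal_shift' t (by omega) hB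
  refine hG.isHocolim X e he (fun i g => ?_) (fun i n g hg => ?_)
  · obtain ⟨D, b, c, hT, hD⟩ := hD (i - B).toNat
    obtain ⟨g', hg'⟩ := tri_lift hT g (hi i _ (t.le_monotone (by omega) _ hD) _)
    exact ⟨_, g', hg'⟩
  · let m : ℕ := max n (i - B + 1).toNat
    obtain ⟨D, b, c, hT, hD⟩ := hD m
    refine ⟨m, le_max_left _ _, ?_⟩
    refine eq_zero_of_comp_tri hT (fun k => hi i _ (le_shift' t (by omega) hD) k) _ ?_
    rw [Category.assoc, he', hg]

/-- If approximations of `F` with smaller and smaller error can be chosen inductively, then `F` is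
a homotopy colimit of the approximating objects. -/
lemma exists_isHocolim_of_approximation {G : C} (hG : IsCompactGenerator G) {t : TStructure C}
    {B : ℤ} (hB : leOrthogonal t B G) {Q : ObjectProperty C} {F : C} (s₀ : Approximation t Q F 0)
    (hs : ∀ (n : ℕ) (s : Approximation t Q F n),
      ∃ (s' : Approximation t Q F (n + 1)) (u : s.obj ⟶ s'.obj), u ≫ s'.hom = s.hom) :
    ∃ (X : ℕ ⥤ C) (e : ∀ n, X.obj n ⟶ F), IsHocolim X F e ∧ ∀ n, Q (X.obj n) := by
  choose next u hu using hs
  let s : ∀ n, Approximation t Q F n := fun n => Nat.rec s₀ next n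
  let X : ℕ ⥤ C := Functor.ofSequence (X := fun n => (s n).obj) fun n => u n (s n)
  refine ⟨X, fun n => (s n).hom, isHocolim_of_triangles hG hB X _ (fun n => ?_)
    fun n => (s n).exists_triangle, fun n => (s n).prop_obj⟩
  rw [show transition X n = u n (s n) from Functor.ofSequence_map_homOfLE_succ _ _]
  exact hu n (s n)

end Sequences

/-! ### Preferred t-structures -/

section Preferred

open scoped ZeroObject

variable {C : Type u} [Category.{v} C] [Preadditive C] [HasZeroObject C] [HasShift C ℤ]
  [∀ n : ℤ, (shiftFunctor C n).Additive] [Pretriangulated C] [IsTriangulated C]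
  [HasCoproducts.{v} C]

lemma ApproxData.le_aisle {G : C} {t : TStructure C} {A : ℕ} (d : ApproxData G t A) :
    t.le 0 ≤ aisle G A := by
  intro F hF
  obtain ⟨X, e, hX, hQ⟩ := exists_isHocolim_of_approximation d.isCompactGenerator
    d.leOrthogonal_obj (Q := aisle G A) (F := F)
    ⟨0, 0, aisle_zero_obj G A, F, 𝟙 F, 0, contractible_distinguished₁ F, by simpa using hF⟩
    (fun n ⟨X, e, hX, D, b, c, hT, hD⟩ => by
      obtain ⟨E, D', a', b', c', hT', ⟨E', hE', r⟩, hD'⟩ := d.exists_triangle (-n) hD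
      have hE : aisle G A E := ⟨E', coprodClosure_mono G (fun i hi => by
        simp only [Set.mem_Icc, Set.mem_Iic] at hi ⊢; omega)
        _ (coprodN_le_coprodClosure G _ _ _ hE'), r⟩
      obtain ⟨P, a, c'', hT'', hP⟩ := HasFibreIn.comp (Q := aisle G A) (aisle_ext G A)
        ⟨X, e, c, hT, hX⟩ ⟨E, a', c', hT', hE⟩
      obtain ⟨u, hu⟩ := tri_lift hT'' e (by
        rw [← Category.assoc, tri_comp₁₂ hT, zero_comp])
      exact ⟨⟨P, a, hP, D', b ≫ b', c'', hT'', t.le_monotone (by push_cast; omega) _ hD'⟩, u, hu⟩)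
  exact aisle_isHocolim G A hX hQ

lemma ApproxData.isPreferred {G : C} {t : TStructure C} {A : ℕ} (d : ApproxData G t A) :
    IsPreferred t :=
  ⟨G, d.isCompactGenerator, A, by exact_mod_cast d.pos, aisle_le t d.le_obj (by omega), d.le_aisle⟩

lemma isCompact_le_minus {t : TStructure C} {G : C} (hG : IsCompactGenerator G) {m : ℤ}
    (hm : t.le m G) : isCompact C ≤ t.minus :=
  haveI : t.minus.IsStableUnderRetracts := ⟨fun r ⟨n, hn⟩ =>
    ⟨n, (t.le_iff_isLE _ _).1 ((t.le n).prop_of_retract r hn.le)⟩⟩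
  hG.isCompact_le t.minus ⟨m, ⟨hm⟩⟩

lemma IsPreferred.isCompact_le_minus {t : TStructure C} (ht : IsPreferred t) :
    isCompact C ≤ t.minus := by
  obtain ⟨G, hG, A, -, h, -⟩ := ht
  exact ApproxTriang.isCompact_le_minus hG
    (le_of_shift t (h _ (by simpa using aisle_of_shift_le G (le_refl (-A)))) le_rfl)

/-- Any two preferred t-structures are equivalent. -/
lemma IsPreferred.exists_le_le {t t' : TStructure C} (ht : IsPreferred t) (ht' : IsPreferred t') :
    ∃ B : ℤ, ∀ n, t.le n ≤ t'.le (n + B) := by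
  obtain ⟨G, hG, A, -, -, h⟩ := ht
  obtain ⟨m, hm⟩ := ht'.isCompact_le_minus G hG.isCompact
  refine ⟨A + m, fun n X hX => le_of_shift t' (i := n) (m := A + m) ?_ le_rfl⟩
  exact aisle_le t' hm.le le_rfl _ (h _ (le_shift' t (by omega) hX))

lemma IsPreferred.exists_ge_le {t t' : TStructure C} (ht : IsPreferred t) (ht' : IsPreferred t') :
    ∃ B : ℤ, ∀ n, t.ge n ≤ t'.ge (n + B) := by
  obtain ⟨B, hB⟩ := ht'.exists_le_le ht
  refine ⟨-B, fun n X hX => ?_⟩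
  obtain ⟨k, hk⟩ : ∃ k, k + 1 = n + -B := ⟨n - B - 1, by omega⟩
  rw [← hk, ge_iff_hom_eq_zero]
  intro Y f hY
  exact hom_eq_zero t (by omega) (hB _ Y hY) hX f

lemma IsPreferred.minusC_eq {t t' : TStructure C} (ht : IsPreferred t) (ht' : IsPreferred t') :
    minusC t = minusC t' := by
  have key : ∀ {t t' : TStructure C}, IsPreferred t → IsPreferred t' → minusC t ≤ minusC t' := by
    intro t t' ht ht' F hF m hm
    obtain ⟨B, hB⟩ := ht.exists_le_le ht'
    obtain ⟨E, D, a, b, c, hT, hE, hD⟩ := hF (max 1 (m + B)) (by omega)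
    exact ⟨E, D, a, b, c, hT, hE, t'.le_monotone (by omega) _ (hB _ _ hD)⟩
  exact le_antisymm (key ht ht') (key ht' ht)

lemma IsPreferred.plus_eq {t t' : TStructure C} (ht : IsPreferred t) (ht' : IsPreferred t') :
    t.plus = t'.plus := by
  have key : ∀ {t t' : TStructure C}, IsPreferred t → IsPreferred t' → t.plus ≤ t'.plus := by
    rintro t t' ht ht' F ⟨n, hn⟩
    obtain ⟨B, hB⟩ := ht.exists_ge_le ht'
    exact ⟨n + B, ⟨hB _ _ hn.ge⟩⟩
  exact le_antisymm (key ht ht') (key ht' ht)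

lemma IsPreferred.minus_eq {t t' : TStructure C} (ht : IsPreferred t) (ht' : IsPreferred t') :
    t.minus = t'.minus := by
  have key : ∀ {t t' : TStructure C}, IsPreferred t → IsPreferred t' → t.minus ≤ t'.minus := by
    rintro t t' ht ht' F ⟨n, hn⟩
    obtain ⟨B, hB⟩ := ht.exists_le_le ht'
    exact ⟨n + B, ⟨hB _ _ hn.le⟩⟩
  exact le_antisymm (key ht ht') (key ht' ht)

lemma IsPreferred.boundedC_eq {t t' : TStructure C} (ht : IsPreferred t) (ht' : IsPreferred t') :
    boundedC t = boundedC t' := by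
  rw [boundedC, boundedC, TStructure.bounded, TStructure.bounded, ht.minusC_eq ht',
    ht.plus_eq ht', ht.minus_eq ht']

/-- Compact objects are bounded with respect to a t-structure as in the definition of
approximability, from both sides. -/
lemma ApproxData.exists_bound {G : C} {t : TStructure C} {A : ℕ} (d : ApproxData G t A) {K : C}
    (hK : isCompact C K) : ∃ B : ℤ, t.le B K ∧ leOrthogonal t (-B) K := by
  let P : ObjectProperty C := fun K => ∃ B : ℤ, t.le B K ∧ leOrthogonal t (-B) K
  have : P.IsStableUnderRetracts := ⟨fun r ⟨B, h₁, h₂⟩ =>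
    ⟨B, (t.le B).prop_of_retract r h₁, (leOrthogonal t (-B)).prop_of_retract r h₂⟩⟩
  have : P.IsTriangulatedClosed₂ := .mk' fun T hT ⟨B₁, h₁, h₁'⟩ ⟨B₃, h₃, h₃'⟩ =>
    ⟨max B₁ B₃, le_ext t _ T hT (t.le_monotone (le_max_left _ _) _ h₁)
      (t.le_monotone (le_max_right _ _) _ h₃),
      leOrthogonal_ext t _ T hT (leOrthogonal_antitone t (by omega) _ h₁')
        (leOrthogonal_antitone t (by omega) _ h₃')⟩
  have : P.IsTriangulated :=
    { exists_zero := ⟨0, isZero_zero C, 0, le_zero_obj t _, leOrthogonal_zero_obj t _⟩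
      isStableUnderShiftBy := fun n => ⟨fun K ⟨B, h₁, h₂⟩ =>
        ⟨max (B - n) (B + n), le_shift' t (by omega) h₁,
          leOrthogonal_shift' t (by omega) h₂⟩⟩ }
  exact d.isCompactGenerator.isCompact_le P ⟨A, d.le_obj, d.leOrthogonal_obj⟩ K hK

end Preferred

/-! ### Objects bounded above -/

section BoundedAbove

variable {C : Type u} [Category.{v} C] [Preadditive C] [HasZeroObject C] [HasShift C ℤ]
  [∀ n : ℤ, (shiftFunctor C n).Additive] [Pretriangulated C]
  {G : C} {t : TStructure C} {A : ℕ} (d : ApproxData G t A)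
include d

/-- If `F` receives no nonzero morphism from `Σ⁻ⁱ G` for `i ≥ k`, then its truncation in
`𝒯^{≤ M}` lies in `𝒯^{≤ M - 1}`, provided that `M` is at least `k + A`: the truncation is a direct
summand of its approximation. -/
lemma ApproxData.le_of_truncation {F : C} {k M : ℤ} (hF : ∀ i ≥ k, ∀ f : G⟦-i⟧ ⟶ F, f = 0)
    {X Z : C} {e : X ⟶ F} {p : F ⟶ Z} {c : Z ⟶ X⟦(1 : ℤ)⟧}
    (hT : Triangle.mk e p c ∈ distTriang C) (hX : t.le M X) (hZ : t.ge (M + 1) Z)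
    (hM : k + A ≤ M) : t.le (M - 1) X := by
  obtain ⟨E, D, a, b, c', hT', hE, hD⟩ := d.exists_triangle M hX
  obtain ⟨l, hl⟩ := tri_desc hT' e (comp_eq_zero_of_retractClosure_coprodClosure
    (fun i hi => hF i (by simp only [Set.mem_Icc] at hi; omega))
    (ObjectProperty.monotone_retractClosure (coprodN_le_coprodClosure G _ _) _ hE) _)
  obtain ⟨r, hr⟩ := tri_lift hT l (hom_eq_zero t (by omega) hD hZ _)
  have h : 𝟙 X - b ≫ r = 0 := by
    refine eq_zero_of_comp_tri hT (fun ψ => ?_) _ ?_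
    · exact hom_eq_zero t (by omega : M < M + 2) hX (t.ge_shift _ _ _ (by omega) _ hZ) ψ
    · rw [Preadditive.sub_comp, Category.id_comp, Category.assoc, hr, hl, sub_self]
  exact (t.le (M - 1)).prop_of_retract ⟨b, r, (sub_eq_zero.1 h).symm⟩ hD

lemma ApproxData.le_of_truncation' {F : C} {k : ℤ} (hF : ∀ i ≥ k, ∀ f : G⟦-i⟧ ⟶ F, f = 0)
    (n : ℕ) {X Z : C} {e : X ⟶ F} {p : F ⟶ Z} {c : Z ⟶ X⟦(1 : ℤ)⟧}
    (hT : Triangle.mk e p c ∈ distTriang C) (hX : t.le (k + A + n) X)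
    (hZ : t.ge (k + A + n + 1) Z) : t.le (k + A - 1) X := by
  induction n with
  | zero => exact d.le_of_truncation hF hT (by simpa using hX) (by simpa using hZ) le_rfl
  | succ n ih =>
    refine ih (t.le_monotone (by push_cast; omega) _ (d.le_of_truncation hF hT hX hZ
      (by push_cast; omega))) (t.ge_antitone (by push_cast; omega) _ hZ)

/-- An object is bounded above if it receives no nonzero morphisms from the shifts `Σ⁻ⁱ G` for
large `i`. -/
lemma ApproxData.minus_of_hom_eq_zero [HasCoproducts.{v} C] [IsTriangulated C] {F : C} {k : ℤ}
    (hF : ∀ i ≥ k, ∀ f : G⟦-i⟧ ⟶ F, f = 0) : t.minus F := by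
  obtain ⟨X, Z, hX, hZ, e, p, c, hT⟩ := t.exists_triangle F (k + A) (k + A + 1) rfl
  have hX' := d.le_of_truncation' hF 0 hT (by simpa using hX) (by simpa using hZ)
  -- By uniqueness of truncations, `Z` is the truncation of `F` above any `M ≥ k + A`.
  have hZ0 : IsZero Z := by
    refine d.isCompactGenerator.isZero Z fun i f => ?_
    obtain ⟨n, hn⟩ : ∃ n : ℕ, A - i ≤ k + A + n := ⟨(-i - k).toNat, by omega⟩
    obtain ⟨X', Z', hX₁, hZ₁, e', p', c', hT'⟩ :=
      t.exists_triangle F (k + A + n) (k + A + n + 1) rfl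
    have hX'' := d.le_of_truncation' hF n hT' hX₁ hZ₁
    obtain ⟨q, hq⟩ := tri_desc hT p' (hom_eq_zero t (by omega) hX' hZ₁ _)
    obtain ⟨q', hq'⟩ := tri_desc hT' p (hom_eq_zero t (by omega) hX'' hZ _)
    have h : q ≫ q' - 𝟙 Z = 0 := by
      obtain ⟨r, hr⟩ := tri_desc₃ hT (q ≫ q' - 𝟙 Z) (by
        rw [Preadditive.comp_sub, ← Category.assoc, hq, hq', Category.comp_id, sub_self])
      rw [← hr, hom_eq_zero t (by omega : k + A - 2 < k + A + 1)
        (le_shift' t (by omega) hX') hZ r, comp_zero]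
    rw [← Category.comp_id f, ← sub_eq_zero.1 h, ← Category.assoc,
      hom_eq_zero t (by omega : A - i < k + A + n + 1) (le_shift' t (by omega) d.le_obj) hZ₁
        (f ≫ q), zero_comp]
  exact ⟨k + A, ⟨le_ext t _ _ hT hX ((le_iff_hom_eq_zero t _ _).2 fun Y f _ =>
    hZ0.eq_of_src _ _)⟩⟩

end BoundedAbove

/-! ### Finiteness of morphism modules -/

section Finiteness

open scoped ZeroObject

variable (R : Type w) [CommRing R]
  {C : Type u} [Category.{v} C] [Preadditive C] [Linear R C]

/-- The objects `F` such that `Hom(K, F)` is a finite `R`-module for all compact `K`. -/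
def homFinite : ObjectProperty C := fun F => ∀ K : C, isCompact C K → Module.Finite R (K ⟶ F)

variable [IsNoetherianRing R] [HasZeroObject C] [HasShift C ℤ]
  [∀ n : ℤ, (shiftFunctor C n).Additive] [∀ n : ℤ, (shiftFunctor C n).Linear R]
  [Pretriangulated C]

lemma finite_hom_from_ext (T : Triangle C) (hT : T ∈ distTriang C) (F : C)
    (h₁ : Module.Finite R (T.obj₁ ⟶ F)) (h₃ : Module.Finite R (T.obj₃ ⟶ F)) :
    Module.Finite R (T.obj₂ ⟶ F) := by
  have := isNoetherian_of_range_eq_ker (Linear.leftComp R F T.mor₂) (Linear.leftComp R F T.mor₁) (by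
    ext φ
    simp only [LinearMap.mem_range, LinearMap.mem_ker, Linear.leftComp_apply]
    constructor
    · rintro ⟨ψ, rfl⟩
      rw [← Category.assoc, comp_distTriang_mor_zero₁₂ _ hT, zero_comp]
    · exact fun h => (T.yoneda_exact₂ hT φ h).imp fun _ h => h.symm)
  infer_instance

lemma finite_hom_to_ext (T : Triangle C) (hT : T ∈ distTriang C) (K : C)
    (h₁ : Module.Finite R (K ⟶ T.obj₁)) (h₃ : Module.Finite R (K ⟶ T.obj₃)) :
    Module.Finite R (K ⟶ T.obj₂) := by
  have := isNoetherian_of_range_eq_ker (Linear.rightComp R K T.mor₁)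
    (Linear.rightComp R K T.mor₂) (by
    ext φ
    simp only [LinearMap.mem_range, LinearMap.mem_ker, Linear.rightComp_apply]
    constructor
    · rintro ⟨ψ, rfl⟩
      rw [Category.assoc, comp_distTriang_mor_zero₁₂ _ hT, comp_zero]
    · exact fun h => (T.coyoneda_exact₂ hT φ h).imp fun _ h => h.symm)
  infer_instance

lemma finite_hom_to_shift {K F : C} (n : ℤ) (h : Module.Finite R (K⟦-n⟧ ⟶ F)) :
    Module.Finite R (K ⟶ F⟦n⟧) := by
  let α : (K⟦-n⟧ ⟶ F) →ₗ[R] (K ⟶ F⟦n⟧) :=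
    Linear.leftComp R _ (shiftNegShift K n).inv ∘ₗ (shiftFunctor C n).mapLinearMap R
  refine Module.Finite.of_surjective α fun ψ => ?_
  obtain ⟨φ, hφ⟩ := exists_shift_eq n ψ
  refine ⟨φ, ?_⟩
  change (shiftNegShift K n).inv ≫ φ⟦n⟧' = ψ
  rw [hφ, Iso.inv_hom_id_assoc]

lemma finite_hom_of_retract {K K' F F' : C} (r : Retract K K') (s : Retract F F')
    (h : Module.Finite R (K' ⟶ F')) : Module.Finite R (K ⟶ F) :=
  Module.Finite.of_surjective (Linear.leftComp R F r.i ∘ₗ Linear.rightComp R K' s.r) fun ψ =>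
    ⟨r.r ≫ ψ ≫ s.i, by simp⟩

instance : (homFinite R : ObjectProperty C).IsStableUnderRetracts where
  of_retract r hY K hK := finite_hom_of_retract R (Retract.refl K) r (hY K hK)

instance : (homFinite R : ObjectProperty C).IsTriangulatedClosed₂ := .mk' fun T hT h₁ h₃ K hK =>
  finite_hom_to_ext R T hT K (h₁ K hK) (h₃ K hK)

instance : (homFinite R : ObjectProperty C).IsTriangulated where
  exists_zero := ⟨_, isZero_zero C, fun K _ =>
    haveI : Subsingleton (K ⟶ (0 : C)) := ⟨fun _ _ => (isZero_zero C).eq_of_tgt _ _⟩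
    inferInstance⟩
  isStableUnderShiftBy n := ⟨fun _ hF _ hK =>
    finite_hom_to_shift R n (hF _ ((isCompact C).le_shift (-n) _ hK))⟩

/-- Finiteness of the morphism modules between compact objects can be tested on a generator. -/
lemma IsCompactGenerator.isCompact_le_homFinite [IsTriangulated C] [HasCoproducts.{v} C] {G : C}
    (hG : IsCompactGenerator G) (h : ∀ i : ℤ, Module.Finite R (G⟦i⟧ ⟶ G)) :
    ApproxTriang.isCompact C ≤ homFinite R := by
  refine hG.isCompact_le _ fun K hK => ?_
  let P : ObjectProperty C := fun K => ∀ i : ℤ, Module.Finite R (K⟦i⟧ ⟶ G)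
  have : P.IsStableUnderRetracts := ⟨fun r h i =>
    finite_hom_of_retract R (r.map (shiftFunctor C i)) (Retract.refl G) (h i)⟩
  have : P.IsTriangulatedClosed₂ := .mk' fun T hT h₁ h₃ i =>
    finite_hom_from_ext R _ (Triangle.shift_distinguished T hT i) G (h₁ i) (h₃ i)
  have : P.IsTriangulated :=
    { exists_zero := ⟨_, isZero_zero C, fun i =>
        haveI : Subsingleton ((0 : C)⟦i⟧ ⟶ G) :=
          ⟨fun _ _ => ((shiftFunctor C i).map_isZero (isZero_zero C)).eq_of_src _ _⟩
        inferInstance⟩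
      isStableUnderShiftBy := fun n => ⟨fun K h i =>
        finite_hom_of_retract R (.ofIso ((shiftFunctorAdd C n i).symm.app K)) (Retract.refl G)
          (h (n + i))⟩ }
  exact finite_hom_of_retract R (.ofIso ((shiftFunctorZero C ℤ).symm.app K)) (Retract.refl G)
    (hG.isCompact_le P h K hK 0)

end Finiteness

/-! ### Approximation of objects with finite morphism modules -/

section FiniteApproximation

open scoped ZeroObject

variable (R : Type w) [CommRing R] [IsNoetherianRing R]
  {C : Type u} [Category.{v} C] [Preadditive C] [Linear R C] [HasZeroObject C] [HasShift C ℤ]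
  [∀ n : ℤ, (shiftFunctor C n).Additive] [∀ n : ℤ, (shiftFunctor C n).Linear R]
  [Pretriangulated C] [IsTriangulated C]

/-- The compact objects of `𝒯^{≤ a}` without nonzero morphisms to objects of `𝒯^{≤ b}`. -/
def compactWithin (t : TStructure C) (a b : ℤ) : ObjectProperty C :=
  isCompact C ⊓ t.le a ⊓ leOrthogonal t b

section CompactWithin

variable {t : TStructure C} {a b : ℤ}

lemma compactWithin_ext [HasCoproducts.{v} C] (T : Triangle C) (hT : T ∈ distTriang C)
    (h₁ : compactWithin t a b T.obj₁) (h₃ : compactWithin t a b T.obj₃) :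
    compactWithin t a b T.obj₂ :=
  ⟨⟨(isCompact C).ext_of_isTriangulatedClosed₂ T hT h₁.1.1 h₃.1.1,
    le_ext t a T hT h₁.1.2 h₃.1.2⟩, leOrthogonal_ext t b T hT h₁.2 h₃.2⟩

lemma compactWithin_zero [HasCoproducts.{v} C] : compactWithin t a b (0 : C) :=
  ⟨⟨(isCompact C).prop_zero, le_zero_obj t a⟩, leOrthogonal_zero_obj t b⟩

lemma compactWithin_mono {a' b' : ℤ} (ha : a ≤ a') (hb : b' ≤ b) :
    compactWithin t a b ≤ compactWithin t a' b' :=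
  fun _ hK => ⟨⟨hK.1.1, t.le_monotone ha _ hK.1.2⟩, leOrthogonal_antitone t hb _ hK.2⟩

end CompactWithin

/-- Finitely many morphisms to `X` can be killed by a morphism from `X` whose fibre is an iterated
extension of their sources. -/
lemma exists_hasFibreIn_comp_eq_zero {Q : ObjectProperty C} (hQ₀ : Q 0)
    (hQ : ∀ T ∈ distTriang C, Q T.obj₁ → Q T.obj₃ → Q T.obj₂) {X : C} {ι : Type*} (s : Finset ι)
    (K : ι → C) (g : ∀ i, K i ⟶ X) (hK : ∀ i ∈ s, Q (K i)) :
    ∃ (X' : C) (f : X ⟶ X'), HasFibreIn Q f ∧ ∀ i ∈ s, g i ≫ f = 0 := by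
  classical
  induction s using Finset.induction_on with
  | empty => exact ⟨X, 𝟙 X, .id hQ₀ X, by simp⟩
  | insert j s hj ih =>
    obtain ⟨X', f, hf, h⟩ := ih fun i hi => hK i (Finset.mem_insert_of_mem hi)
    obtain ⟨X'', f', c, hT⟩ := distinguished_cocone_triangle (g j ≫ f)
    refine ⟨X'', f ≫ f', hf.comp hQ ⟨_, _, c, hT, hK j (Finset.mem_insert_self _ _)⟩,
      fun i hi => ?_⟩
    rw [← Category.assoc]
    obtain rfl | hi := Finset.mem_insert.1 hi
    · exact tri_comp₁₂ hT
    · rw [h i hi, zero_comp]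

variable {R}

lemma exists_isGhost {Q : ObjectProperty C} (hQ₀ : Q 0)
    (hQ : ∀ T ∈ distTriang C, Q T.obj₁ → Q T.obj₃ → Q T.obj₂) {G : C} {S : Set ℤ} (hS : S.Finite)
    (hGQ : ∀ i ∈ S, Q (G⟦-i⟧)) (hG : isCompact C G) {X : C} (hX : homFinite R X) :
    ∃ (X' : C) (f : X ⟶ X'), HasFibreIn Q f ∧ IsGhost G S f := by
  have hfin (i : ℤ) : Module.Finite R (G⟦-i⟧ ⟶ X) := hX _ ((isCompact C).le_shift _ _ hG)
  choose s hs using fun i => (hfin i).fg_top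
  obtain ⟨X', f, hf, h⟩ := exists_hasFibreIn_comp_eq_zero hQ₀ hQ
    (hS.toFinset.sigma s) (fun p : (Σ i : ℤ, (G⟦-i⟧ ⟶ X)) => G⟦-p.1⟧) (fun p => p.2)
    (fun p hp => hGQ _ (by simpa using (Finset.mem_sigma.1 hp).1))
  refine ⟨X', f, hf, fun i hi g => ?_⟩
  have hle : Submodule.span R (s i : Set (G⟦-i⟧ ⟶ X)) ≤
      LinearMap.ker (Linear.rightComp R (G⟦-i⟧) f) :=
    Submodule.span_le.2 fun g hg => h ⟨i, g⟩ (Finset.mem_sigma.2 ⟨by simpa using hi, hg⟩)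
  rw [hs] at hle
  exact hle (Submodule.mem_top (x := g))

lemma HasFibreIn.homFinite [HasCoproducts.{v} C] {Q : ObjectProperty C} (hQ : Q ≤ homFinite R)
    {X Y : C} {f : X ⟶ Y} (hf : HasFibreIn Q f) (hX : homFinite R X) : homFinite R Y := by
  obtain ⟨P, a, c, hT, hP⟩ := hf
  exact ApproxTriang.homFinite R |>.ext_of_isTriangulatedClosed₂ _ (tri_rot hT) hX
    ((ApproxTriang.homFinite R).le_shift 1 _ (hQ _ hP))

lemma exists_isGhostComp [HasCoproducts.{v} C] {Q : ObjectProperty C} (hQ₀ : Q 0)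
    (hQ : ∀ T ∈ distTriang C, Q T.obj₁ → Q T.obj₃ → Q T.obj₂) (hQR : Q ≤ homFinite R) {G : C}
    {S : Set ℤ} (hS : S.Finite) (hGQ : ∀ i ∈ S, Q (G⟦-i⟧)) (hG : isCompact C G) (n : ℕ) {X : C}
    (hX : homFinite R X) :
    ∃ (X' : C) (f : X ⟶ X'), HasFibreIn Q f ∧ IsGhostComp G S n f := by
  induction n generalizing X with
  | zero => exact ⟨X, 𝟙 X, .id hQ₀ X, .id X⟩
  | succ n ih =>
    obtain ⟨X', f, hf, hf'⟩ := exists_isGhost hQ₀ hQ hS hGQ hG hX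
    obtain ⟨X'', g, hg, hg'⟩ := ih (hf.homFinite hQR hX)
    exact ⟨X'', f ≫ g, hf.comp hQ hg, .comp hf' hg'⟩

namespace ApproxData

variable [HasCoproducts.{v} C] {G : C} {t : TStructure C} {A : ℕ} (d : ApproxData G t A)
  (hR : isCompact C ≤ homFinite R)
include d hR

/-- Let `u : F ⟶ X` factor through `𝒯^{≤ M}`.  There is a morphism `w : X ⟶ X'` such that `u ≫ w`
factors through `𝒯^{≤ M - m}`, whose fibre is compact and bounded: it is built from the `Σ⁻ⁱ G` with
`M - m + 1 - A ≤ i ≤ M + A`. -/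
lemma exists_comp_factor {M : ℤ} (m : ℕ) {F X D : C} (hX : homFinite R X) (hD : t.le M D)
    (b : F ⟶ D) (g : D ⟶ X) :
    ∃ (X' D' : C) (w : X ⟶ X') (b' : F ⟶ D') (g' : D' ⟶ X'), homFinite R X' ∧ t.le (M - m) D' ∧
      b' ≫ g' = (b ≫ g) ≫ w ∧ HasFibreIn (compactWithin t (M + 2 * A) (M - m + 1 - 2 * A)) w := by
  have hle {a b : ℤ} : compactWithin t a b ≤ homFinite R := fun K hK => hR K hK.1.1
  induction m with
  | zero =>
    exact ⟨X, D, 𝟙 X, b, g, hX, by simpa using hD, by simp, .id compactWithin_zero X⟩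
  | succ m ih =>
    obtain ⟨X', D', w, b', g', hX', hD', h, hw⟩ := ih
    obtain ⟨D'', b'', hD'', hb''⟩ := d.exists_factor _ hD'
    obtain ⟨X'', f, hf, hf'⟩ := exists_isGhostComp
      (Q := compactWithin t (M - m + 2 * A) (M - m - 2 * A)) compactWithin_zero
      compactWithin_ext hle (Set.finite_Icc (M - m - (A : ℤ)) (M - m + A)) (fun i hi => by
        simp only [Set.mem_Icc] at hi
        exact ⟨⟨(isCompact C).le_shift _ _ d.isCompactGenerator.isCompact,
          le_shift' t (by omega) d.le_obj⟩, leOrthogonal_shift' t (by omega) d.leOrthogonal_obj⟩)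
      d.isCompactGenerator.isCompact A hX'
    obtain ⟨g'', hg''⟩ := hb'' g' f hf'
    refine ⟨X'', D'', w ≫ f, b' ≫ b'', g'', hf.homFinite hle hX',
      t.le_monotone (by push_cast; omega) _ hD'', ?_, ?_⟩
    · rw [Category.assoc, hg'', ← Category.assoc, h, Category.assoc]
    · exact (hw.mono (compactWithin_mono le_rfl (by push_cast; omega))).comp compactWithin_ext
        (hf.mono (compactWithin_mono (by omega) (by push_cast; omega)))

/-- An object of `𝒯^{≤ N}` with finite morphism modules has a morphism with compact fibre to an
object of `𝒯^{≤ N - 1}`. -/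
lemma exists_hasFibreIn_isCompact {N : ℤ} {F : C} (hF : homFinite R F) (hN : t.le N F) :
    ∃ (Z : C) (f : F ⟶ Z), HasFibreIn (isCompact C) f ∧ t.le (N - 1) Z := by
  have hQ := (isCompact C).ext_of_isTriangulatedClosed₂
  have hA := d.pos
  -- The number of steps in `u` makes the cone of `w` lie in `𝒯^{≤ N - 2}`, and the number of steps
  -- in `w` makes all morphisms from the fibre `K` of `u` to `D'` vanish.
  obtain ⟨X, D, u, b, g, hX, hD, hu, K, a, k, hT, hK⟩ :=
    d.exists_comp_factor hR (2 * A + 1) hF hN (𝟙 F) (𝟙 F)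
  obtain ⟨X', D', w, b', g', hX', hD', hw, K', a', k', hT', hK'⟩ :=
    d.exists_comp_factor hR (2 * A) hX hD b g
  replace hu : b ≫ g = u := by simpa using hu
  rw [hu] at hw
  have hKD : t.le (N - ↑(2 * A + 1) + 1 - 2 * A) D' := t.le_monotone (by omega) _ hD'
  obtain ⟨e, he⟩ := tri_desc hT b' (hK.2 D' hKD _)
  obtain ⟨r, hr⟩ := tri_desc₃ hT (w - e ≫ g') (by
    rw [Preadditive.comp_sub, ← Category.assoc, he, hw, sub_self])
  obtain ⟨Z, q, z, hZ⟩ := distinguished_cocone_triangle r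
  refine ⟨Z, (u ≫ w) ≫ q, ((HasFibreIn.comp hQ ⟨K, a, k, hT, hK.1.1⟩
    ⟨K', a', k', hT', hK'.1.1⟩).comp hQ ⟨_, r, z, hZ, (isCompact C).le_shift 1 _ hK.1.1⟩), ?_⟩
  rw [le_iff_hom_eq_zero]
  intro W f hW
  have hzero {Y : C} (hY : t.le (N - 2) Y) (φ : Y ⟶ W) : φ = 0 := hom_eq_zero t (by omega) hY hW φ
  have hD'W (φ : D' ⟶ W) : φ = 0 := hzero (t.le_monotone (by push_cast; omega) _ hD') φ
  have hwr : w = k ≫ r + e ≫ g' := by rw [hr, sub_add_cancel]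
  have hqf : q ≫ f = 0 := by
    obtain ⟨ψ, hψ⟩ := tri_desc₃ hT' (q ≫ f) (by
      rw [← Category.assoc, hwr, Preadditive.add_comp, Category.assoc, tri_comp₁₂ hZ, comp_zero,
        zero_add, Category.assoc, Category.assoc, hD'W (g' ≫ q ≫ f), comp_zero])
    have h0 : ψ = 0 := hzero (le_shift' t (by push_cast; omega) hK'.1.2) ψ
    rw [← hψ, h0, comp_zero]
  obtain ⟨y, rfl⟩ := tri_desc₃ hZ f hqf
  -- It remains to see that `y` factors through the shift of `r`.
  have hrot := tri_rot (tri_rot (tri_rot hT'))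
  obtain ⟨p, hp⟩ := tri_desc hrot (k⟦(1 : ℤ)⟧' ≫ y)
    (hzero (le_shift' t (by push_cast; omega) hK'.1.2) _)
  have hp' : k⟦(1 : ℤ)⟧' ≫ (y + r⟦(1 : ℤ)⟧' ≫ p) = 0 := by
    have h : w⟦(1 : ℤ)⟧' ≫ p = (k ≫ r)⟦(1 : ℤ)⟧' ≫ p := by
      have h0 : g'⟦(1 : ℤ)⟧' ≫ p = 0 :=
        hzero (le_shift' t (by push_cast; omega) hD') _
      rw [hwr, Functor.map_add, Preadditive.add_comp, Functor.map_comp _ e, Category.assoc, h0,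
        comp_zero, add_zero]
    rw [Preadditive.comp_add, ← hp, ← Category.assoc, ← Functor.map_comp, ← h,
      Preadditive.neg_comp, neg_add_cancel]
  obtain ⟨ψ, hψ⟩ := tri_desc₃ (tri_rot (tri_rot (tri_rot (tri_rot hT)))) (y + r⟦(1 : ℤ)⟧' ≫ p) (by
    rw [Preadditive.neg_comp, hp', neg_zero])
  have h0 : ψ = 0 := hzero (le_shift' t (m := N - 1) (by omega)
    (le_shift' t (m := N) (by omega) hN)) ψ
  rw [h0, comp_zero] at hψ
  rw [eq_neg_of_add_eq_zero_left hψ.symm, Preadditive.comp_neg, ← Category.assoc, tri_comp₃₁ hZ,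
    zero_comp, neg_zero]

/-- An object which is bounded above and has finite morphism modules lies in `𝒯⁻_c`. -/
lemma minusC_of_homFinite {F : C} (hF : homFinite R F) (hF' : t.minus F) : minusC t F := by
  obtain ⟨N, hN⟩ := hF'
  have key (n : ℕ) : ∃ (Z : C) (f : F ⟶ Z), HasFibreIn (isCompact C) f ∧ t.le (N - n) Z := by
    induction n with
    | zero => exact ⟨F, 𝟙 F, .id (isCompact C).prop_zero F, by simpa using hN.le⟩
    | succ n ih =>
      obtain ⟨Z, f, hf, hZ⟩ := ih
      obtain ⟨Z', f', hf', hZ'⟩ := d.exists_hasFibreIn_isCompact hR (hf.homFinite hR hF) hZ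
      exact ⟨Z', f ≫ f', hf.comp (isCompact C).ext_of_isTriangulatedClosed₂ hf',
        t.le_monotone (by push_cast; omega) _ hZ'⟩
  intro m _
  obtain ⟨Z, f, ⟨P, a, c, hT, hP⟩, hZ⟩ := key (N + m).toNat
  exact ⟨P, Z, a, f, c, hT, hP, t.le_monotone (by omega) _ hZ⟩

end ApproxData

end FiniteApproximation

/-! ### Cohomological functors -/

section CohomologicalFunctors

variable {R : Type w} [CommRing R] {C : Type u} [Category.{v} C] [Preadditive C] [Linear R C]
  {P : ObjectProperty C}

lemma map_comp_apply (H : P.FullSubcategoryᵒᵖ ⥤ ModuleCat.{v} R) {X Y Z : P.FullSubcategory}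
    (f : X ⟶ Y) (g : Y ⟶ Z) (z : H.obj (op Z)) :
    H.map (f ≫ g).op z = H.map f.op (H.map g.op z) := by
  rw [op_comp, H.map_comp, ModuleCat.comp_apply]

lemma map_id_apply (H : P.FullSubcategoryᵒᵖ ⥤ ModuleCat.{v} R) {X : P.FullSubcategory}
    (x : H.obj (op X)) : H.map (𝟙 X).op x = x := by
  rw [op_id, H.map_id, ModuleCat.id_apply]

lemma naturality_op_apply {H₁ H₂ : P.FullSubcategoryᵒᵖ ⥤ ModuleCat.{v} R} (τ : H₁ ⟶ H₂)
    {X Y : P.FullSubcategory} (f : X ⟶ Y) (y : H₁.obj (op Y)) :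
    τ.app (op X) (H₁.map f.op y) = H₂.map f.op (τ.app (op Y) y) := by
  rw [← ModuleCat.comp_apply, ← ModuleCat.comp_apply, τ.naturality]

lemma bijective_app_of_retract {H₁ H₂ : P.FullSubcategoryᵒᵖ ⥤ ModuleCat.{v} R} (τ : H₁ ⟶ H₂)
    {X Y : P.FullSubcategory} (r : Retract X.obj Y.obj)
    (h : Function.Bijective (τ.app (op Y))) : Function.Bijective (τ.app (op X)) := by
  let i : X ⟶ Y := ObjectProperty.homMk r.i
  let p : Y ⟶ X := ObjectProperty.homMk r.r
  have hip : i ≫ p = 𝟙 X := ObjectProperty.hom_ext _ r.retract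
  have key (H : P.FullSubcategoryᵒᵖ ⥤ ModuleCat.{v} R) (x : H.obj (op X)) :
      H.map i.op (H.map p.op x) = x := by
    rw [← map_comp_apply, hip, map_id_apply]
  refine ⟨fun x y hxy => ?_, fun z => ?_⟩
  · rw [← key _ x, ← key _ y]
    congr 1
    apply h.1
    rw [naturality_op_apply, naturality_op_apply, hxy]
  · obtain ⟨w, hw⟩ := h.2 (H₂.map p.op z)
    exact ⟨H₁.map i.op w, by rw [naturality_op_apply, hw, key]⟩

variable [HasZeroObject C] [HasShift C ℤ] [∀ n : ℤ, (shiftFunctor C n).Additive]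
  [Pretriangulated C] [P.IsStableUnderShift ℤ]

lemma isCohomological_restrictedYoneda (F : C) :
    IsCohomological ((restrictedYoneda R P).obj F) where
  map_add f g := by
    ext φ
    exact Preadditive.add_comp _ _ _ f.hom g.hom φ
  map_smul r f := by
    ext φ
    exact Linear.smul_comp _ _ _ r f.hom φ
  exact {X Y Z} f g h hT φ := ⟨fun hφ => tri_desc hT φ hφ, by
    have h0 (ψ : Z.obj ⟶ F) : f.hom ≫ g.hom ≫ ψ = 0 := by
      rw [← Category.assoc, tri_comp₁₂ hT, zero_comp]
    rintro ⟨ψ, rfl⟩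
    exact h0 ψ⟩

namespace IsCohomological

variable {H : P.FullSubcategoryᵒᵖ ⥤ ModuleCat.{v} R} (hH : IsCohomological H)
include hH

lemma map_zero {X Y : P.FullSubcategory} : H.map (0 : X ⟶ Y).op = 0 := by
  have := hH.map_add (0 : X ⟶ Y) 0
  rwa [add_zero, left_eq_add] at this

lemma of_iso {H' : P.FullSubcategoryᵒᵖ ⥤ ModuleCat.{v} R} (e : H ≅ H') : IsCohomological H' where
  map_add f g := by
    rw [← NatIso.naturality_1 e, hH.map_add, Preadditive.add_comp, Preadditive.comp_add,
      NatIso.naturality_1, NatIso.naturality_1]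
  map_smul r f := by
    rw [← NatIso.naturality_1 e, hH.map_smul, Linear.smul_comp, Linear.comp_smul,
      NatIso.naturality_1]
  exact {X Y Z} f g h hT := by
    have hinv (K : P.FullSubcategory) (x : H'.obj (op K)) :
        e.hom.app (op K) (e.inv.app (op K) x) = x := by
      rw [← ModuleCat.comp_apply, Iso.inv_hom_id_app, ModuleCat.id_apply]
    intro y
    rw [← hinv Y y, ← naturality_op_apply]
    constructor
    · intro hy
      replace hy : H.map f.op (e.inv.app (op Y) y) = 0 := by
        have := congr_arg (e.inv.app (op X)) hy
        rwa [_root_.map_zero, ← ModuleCat.comp_apply, Iso.hom_inv_id_app,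
          ModuleCat.id_apply] at this
      obtain ⟨z, hz⟩ := (hH.exact f g h hT _).1 hy
      exact ⟨e.hom.app (op Z) z, by rw [← naturality_op_apply, hz]⟩
    · rintro ⟨z, hz⟩
      rw [(hH.exact f g h hT _).2 ⟨e.inv.app (op Z) z, ?_⟩, _root_.map_zero]
      rw [← naturality_op_apply, hz, ← ModuleCat.comp_apply, Iso.hom_inv_id_app,
        ModuleCat.id_apply]

/-- The five lemma. -/
lemma bijective_app {H' : P.FullSubcategoryᵒᵖ ⥤ ModuleCat.{v} R} (hH' : IsCohomological H')
    (τ : H ⟶ H') {T : Triangle C} (hT : T ∈ distTriang C) (h₁ : P T.obj₁) (h₂ : P T.obj₂)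
    (h₃ : P T.obj₃)
    (b₁ : Function.Bijective (τ.app (op ⟨T.obj₁, h₁⟩)))
    (b₃ : Function.Bijective (τ.app (op ⟨T.obj₃, h₃⟩)))
    (b₁' : Function.Bijective (τ.app (op (shiftObj ⟨T.obj₁, h₁⟩ 1))))
    (b₃' : Function.Bijective (τ.app (op (shiftObj ⟨T.obj₃, h₃⟩ (-1))))) :
    Function.Bijective (τ.app (op ⟨T.obj₂, h₂⟩)) := by
  let f₀ : shiftObj ⟨T.obj₃, h₃⟩ (-1) ⟶ (⟨T.obj₁, h₁⟩ : P.FullSubcategory) :=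
    ObjectProperty.homMk T.invRotate.mor₁
  let f₁ : (⟨T.obj₁, h₁⟩ : P.FullSubcategory) ⟶ ⟨T.obj₂, h₂⟩ := ObjectProperty.homMk T.mor₁
  let f₂ : (⟨T.obj₂, h₂⟩ : P.FullSubcategory) ⟶ ⟨T.obj₃, h₃⟩ := ObjectProperty.homMk T.mor₂
  let f₃ : (⟨T.obj₃, h₃⟩ : P.FullSubcategory) ⟶ shiftObj ⟨T.obj₁, h₁⟩ 1 :=
    ObjectProperty.homMk T.mor₃
  have e₁ {H : P.FullSubcategoryᵒᵖ ⥤ ModuleCat.{v} R} (hH : IsCohomological H) :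
      Function.Exact (H.map f₁.op) (H.map f₀.op) :=
    hH.exact f₀ f₁ T.invRotate.mor₃ (inv_rot_of_distTriang _ hT)
  have e₂ {H : P.FullSubcategoryᵒᵖ ⥤ ModuleCat.{v} R} (hH : IsCohomological H) :
      Function.Exact (H.map f₂.op) (H.map f₁.op) := hH.exact f₁ f₂ T.mor₃ hT
  have e₃ {H : P.FullSubcategoryᵒᵖ ⥤ ModuleCat.{v} R} (hH : IsCohomological H) :
      Function.Exact (H.map f₃.op) (H.map f₂.op) :=
    hH.exact f₂ f₃ T.rotate.mor₃ (rot_of_distTriang _ hT)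
  have comm {X Y : P.FullSubcategory} (f : X ⟶ Y) :
      (H'.map f.op).hom ∘ₗ (τ.app (op Y)).hom = (τ.app (op X)).hom ∘ₗ (H.map f.op).hom := by
    ext x
    exact (naturality_op_apply τ f x).symm
  exact LinearMap.bijective_of_surjective_of_bijective_of_bijective_of_injective
    (H.map f₃.op).hom (H.map f₂.op).hom (H.map f₁.op).hom (H.map f₀.op).hom
    (H'.map f₃.op).hom (H'.map f₂.op).hom (H'.map f₁.op).hom (H'.map f₀.op).hom
    (τ.app _).hom (τ.app _).hom (τ.app _).hom (τ.app _).hom (τ.app _).hom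
    (comm f₃) (comm f₂) (comm f₁) (comm f₀) (e₃ hH) (e₂ hH) (e₁ hH) (e₃ hH') (e₂ hH') (e₁ hH')
    b₁'.2 b₃ b₁ b₃'.1

end IsCohomological

/-- A morphism of cohomological functors on the compact objects is an isomorphism if it is so at the
shifts of a compact generator. -/
lemma IsCompactGenerator.isIso_of_isCohomological [IsTriangulated C] [HasCoproducts.{v} C] {G : C}
    (hG : IsCompactGenerator G)
    {H H' : (ApproxTriang.isCompact C).FullSubcategoryᵒᵖ ⥤ ModuleCat.{v} R}
    (hH : IsCohomological H) (hH' : IsCohomological H') (τ : H ⟶ H')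
    (hτ : ∀ i : ℤ, Function.Bijective (τ.app (op (shiftObj ⟨G, hG.isCompact⟩ i)))) : IsIso τ := by
  let Q : ObjectProperty C := fun K => ∃ hK : ApproxTriang.isCompact C K,
    ∀ i : ℤ, Function.Bijective (τ.app (op (shiftObj ⟨K, hK⟩ i)))
  have hQG : Q G := ⟨hG.isCompact, hτ⟩
  have : Q.IsStableUnderRetracts := ⟨fun r ⟨hK, h⟩ =>
    ⟨(ApproxTriang.isCompact C).prop_of_retract r hK, fun i =>
      bijective_app_of_retract τ (r.map (shiftFunctor C i)) (h i)⟩⟩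
  have hshift {K : C} (hK : Q K) (n : ℤ) : Q (K⟦n⟧) :=
    ⟨(ApproxTriang.isCompact C).le_shift n _ hK.1, fun i =>
      bijective_app_of_retract τ (Y := shiftObj ⟨K, hK.1⟩ (n + i))
        (.ofIso ((shiftFunctorAdd C n i).symm.app K)) (hK.2 (n + i))⟩
  have : Q.IsTriangulatedClosed₂ := .mk' fun T hT ⟨h₁, b₁⟩ ⟨h₃, b₃⟩ => by
    have h₂ := (ApproxTriang.isCompact C).ext_of_isTriangulatedClosed₂ T hT h₁ h₃
    exact ⟨h₂, fun i => hH.bijective_app hH' τ (Triangle.shift_distinguished T hT i)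
      ((ApproxTriang.isCompact C).le_shift i _ h₁) ((ApproxTriang.isCompact C).le_shift i _ h₂)
      ((ApproxTriang.isCompact C).le_shift i _ h₃) (b₁ i) (b₃ i)
      ((hshift ⟨h₁, b₁⟩ i).2 1) ((hshift ⟨h₃, b₃⟩ i).2 (-1))⟩
  have : Q.IsTriangulated :=
    { exists_zero := ⟨_, isZero_zero C, Q.prop_of_retract ⟨0, 0, by simp⟩ hQG⟩
      isStableUnderShiftBy := fun n => ⟨fun K hK => hshift hK n⟩ }
  have key (K : (ApproxTriang.isCompact C).FullSubcategory) :
      Function.Bijective (τ.app (op K)) :=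
    bijective_app_of_retract τ (Y := shiftObj K 0)
      (.ofIso ((shiftFunctorZero C ℤ).symm.app K.obj))
      ((hG.isCompact_le Q hQG K.obj K.property).2 0)
  have (K : (ApproxTriang.isCompact C).FullSubcategoryᵒᵖ) : IsIso (τ.app K) :=
    (ConcreteCategory.isIso_iff_bijective _).2 (key K.unop)
  exact NatIso.isIso_of_isIso_app τ

end CohomologicalFunctors

/-! ### Representability of locally finite functors -/

section Representability

open scoped ZeroObject

variable {R : Type w} [CommRing R] {C : Type u} [Category.{v} C] [Preadditive C] [Linear R C]

namespace IsCohomological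

variable [HasZeroObject C] [HasShift C ℤ]
  [∀ n : ℤ, (shiftFunctor C n).Additive] [Pretriangulated C]

section Evaluation

variable {P : ObjectProperty C} [P.IsStableUnderShift ℤ]
  {H : P.FullSubcategoryᵒᵖ ⥤ ModuleCat.{v} R} (hH : IsCohomological H)

/-- The linear map `Hom(K, E) → H(K)` which corresponds to an element of `H(E)` by the Yoneda
lemma. -/
def eval {E : P.FullSubcategory} (y : H.obj (op E)) (K : P.FullSubcategory) :
    (K.obj ⟶ E.obj) →ₗ[R] H.obj (op K) where
  toFun g := H.map (ObjectProperty.homMk g : K ⟶ E).op y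
  map_add' g g' := by
    have h : (ObjectProperty.homMk (g + g') : K ⟶ E) =
      ObjectProperty.homMk g + ObjectProperty.homMk g' := rfl
    rw [h, hH.map_add]
    rfl
  map_smul' r g := by
    have h : (ObjectProperty.homMk (r • g) : K ⟶ E) = r • ObjectProperty.homMk g := rfl
    rw [h, hH.map_smul]
    rfl

lemma eval_comp {E E' : P.FullSubcategory} (y : H.obj (op E')) (f : E ⟶ E')
    {K : P.FullSubcategory} (g : K.obj ⟶ E.obj) :
    hH.eval y K (g ≫ f.hom) = hH.eval (H.map f.op y) K g :=
  map_comp_apply H (ObjectProperty.homMk g) f y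

end Evaluation

variable [HasCoproducts.{v} C]
  {H : (isCompact C).FullSubcategoryᵒᵖ ⥤ ModuleCat.{v} R} (hH : IsCohomological H)
include hH

/-- Finitely many elements can be added to the image of an evaluation map by enlarging the
object. -/
lemma exists_eval_eq {ι : Type*} (s : Finset ι) (K : ι → (isCompact C).FullSubcategory)
    (z : ∀ i, H.obj (op (K i))) (E : (isCompact C).FullSubcategory) (y : H.obj (op E)) :
    ∃ (E' : (isCompact C).FullSubcategory) (y' : H.obj (op E')) (f : E ⟶ E'), H.map f.op y' = y ∧
      ∀ i ∈ s, ∃ g : (K i).obj ⟶ E'.obj, hH.eval y' (K i) g = z i := by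
  classical
  induction s using Finset.induction_on with
  | empty => exact ⟨E, y, 𝟙 E, map_id_apply H y, by simp⟩
  | insert j s hj ih =>
    obtain ⟨E', y', f, hf, h⟩ := ih
    let E'' : (isCompact C).FullSubcategory := ⟨E'.obj ⊞ (K j).obj,
      (isCompact C).ext_of_isTriangulatedClosed₂ _
        (binaryBiproductTriangle_distinguished E'.obj (K j).obj) E'.property (K j).property⟩
    let inl : E' ⟶ E'' := ObjectProperty.homMk biprod.inl
    let inr : K j ⟶ E'' := ObjectProperty.homMk biprod.inr
    let fst : E'' ⟶ E' := ObjectProperty.homMk biprod.fst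
    let snd : E'' ⟶ K j := ObjectProperty.homMk biprod.snd
    have h₁ : inl ≫ fst = 𝟙 _ := ObjectProperty.hom_ext _ biprod.inl_fst
    have h₂ : inl ≫ snd = 0 := ObjectProperty.hom_ext _ biprod.inl_snd
    have h₃ : inr ≫ fst = 0 := ObjectProperty.hom_ext _ biprod.inr_fst
    have h₄ : inr ≫ snd = 𝟙 _ := ObjectProperty.hom_ext _ biprod.inr_snd
    let y'' : H.obj (op E'') := H.map fst.op y' + H.map snd.op (z j)
    have hl : H.map inl.op y'' = y' := by
      rw [_root_.map_add (H.map inl.op).hom, ← map_comp_apply, ← map_comp_apply, h₁, h₂, hH.map_zero,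
        map_id_apply]
      exact add_zero _
    have hr : H.map inr.op y'' = z j := by
      rw [_root_.map_add (H.map inr.op).hom, ← map_comp_apply, ← map_comp_apply, h₃, h₄, hH.map_zero,
        map_id_apply]
      exact zero_add _
    refine ⟨E'', y'', f ≫ inl, by rw [map_comp_apply, hl, hf], fun i hi => ?_⟩
    obtain rfl | hi := Finset.mem_insert.1 hi
    · exact ⟨inr.hom, hr⟩
    · obtain ⟨g, hg⟩ := h i hi
      exact ⟨g ≫ inl.hom, by rw [hH.eval_comp, hl, hg]⟩

/-- Finitely many elements of the kernels of the evaluation maps can be killed. -/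
lemma exists_comp_eq_zero {ι : Type*} (s : Finset ι) (K : ι → (isCompact C).FullSubcategory)
    {E : (isCompact C).FullSubcategory} (y : H.obj (op E)) (g : ∀ i, (K i).obj ⟶ E.obj)
    (hg : ∀ i ∈ s, hH.eval y (K i) (g i) = 0) :
    ∃ (E' : (isCompact C).FullSubcategory) (y' : H.obj (op E')) (f : E ⟶ E'), H.map f.op y' = y ∧
      ∀ i ∈ s, g i ≫ f.hom = 0 := by
  classical
  induction s using Finset.induction_on with
  | empty => exact ⟨E, y, 𝟙 E, map_id_apply H y, by simp⟩
  | insert j s hj ih =>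
    obtain ⟨E', y', f, hf, h⟩ := ih fun i hi => hg i (Finset.mem_insert_of_mem hi)
    obtain ⟨Z, p, c, hT⟩ := distinguished_cocone_triangle (g j ≫ f.hom)
    let E'' : (isCompact C).FullSubcategory := ⟨Z,
      (isCompact C).ext_of_isTriangulatedClosed₃ _ hT (K j).property E'.property⟩
    let p' : E' ⟶ E'' := ObjectProperty.homMk p
    obtain ⟨y'', hy''⟩ := (hH.exact (ObjectProperty.homMk (g j ≫ f.hom)) p' c hT y').1 (by
      change hH.eval y' (K j) (g j ≫ f.hom) = 0
      rw [hH.eval_comp, hf, hg j (Finset.mem_insert_self _ _)])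
    refine ⟨E'', y'', f ≫ p', by rw [map_comp_apply, hy'', hf], fun i hi => ?_⟩
    rw [ObjectProperty.FullSubcategory.comp_hom, ← Category.assoc]
    obtain rfl | hi := Finset.mem_insert.1 hi
    · exact tri_comp₁₂ hT
    · rw [h i hi, zero_comp]

/-- One step in the construction of a sequence of compact objects whose colimit represents `H`. -/
lemma exists_next [IsNoetherianRing R] (hR : isCompact C ≤ homFinite R)
    (G : (isCompact C).FullSubcategory) (hG : ∀ i : ℤ, Module.Finite R (H.obj (op (shiftObj G i))))
    {S : Set ℤ} (hS : S.Finite) (E : (isCompact C).FullSubcategory) (y : H.obj (op E)) :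
    ∃ (E' : (isCompact C).FullSubcategory) (y' : H.obj (op E')) (f : E ⟶ E'), H.map f.op y' = y ∧
      ∀ i ∈ S, Function.Surjective (hH.eval y' (shiftObj G i)) ∧
        ∀ g : (shiftObj G i).obj ⟶ E.obj, hH.eval y (shiftObj G i) g = 0 → g ≫ f.hom = 0 := by
  choose s hs using fun i => (hG i).fg_top
  obtain ⟨E₁, y₁, f₁, hf₁, h₁⟩ := hH.exists_eval_eq (hS.toFinset.sigma s)
    (fun p : (Σ i : ℤ, H.obj (op (shiftObj G i))) => shiftObj G p.1) (fun p => p.2) E y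
  have hfin (i : ℤ) : Module.Finite R ((shiftObj G i).obj ⟶ E₁.obj) :=
    hR _ E₁.property _ (shiftObj G i).property
  choose r hr using fun i =>
    IsNoetherian.noetherian (LinearMap.ker (hH.eval y₁ (shiftObj G i)))
  obtain ⟨E₂, y₂, f₂, hf₂, h₂⟩ := hH.exists_comp_eq_zero (hS.toFinset.sigma r)
    (fun p : (Σ i : ℤ, ((shiftObj G i).obj ⟶ E₁.obj)) => shiftObj G p.1) y₁ (fun p => p.2)
    (fun p hp => by
      have : p.2 ∈ LinearMap.ker (hH.eval y₁ (shiftObj G p.1)) := by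
        rw [← hr]
        exact Submodule.subset_span (Finset.mem_sigma.1 hp).2
      exact this)
  refine ⟨E₂, y₂, f₁ ≫ f₂, by rw [map_comp_apply, hf₂, hf₁], fun i hi => ⟨?_, fun g hg => ?_⟩⟩
  · rw [← LinearMap.range_eq_top, eq_top_iff, ← hs i, Submodule.span_le]
    intro z hz
    obtain ⟨g, hg⟩ := h₁ ⟨i, z⟩ (Finset.mem_sigma.2 ⟨by simpa using hi, hz⟩)
    exact ⟨g ≫ f₂.hom, by rw [hH.eval_comp, hf₂, hg]⟩
  · have hle : LinearMap.ker (hH.eval y₁ (shiftObj G i)) ≤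
        LinearMap.ker (Linear.rightComp R (shiftObj G i).obj f₂.hom) := by
      rw [← hr i, Submodule.span_le]
      exact fun k hk => h₂ ⟨i, k⟩ (Finset.mem_sigma.2 ⟨by simpa using hi, hk⟩)
    have := @hle (g ≫ f₁.hom) (by rw [LinearMap.mem_ker, hH.eval_comp, hf₁, hg])
    rw [ObjectProperty.FullSubcategory.comp_hom, ← Category.assoc]
    exact this

lemma exists_sequence [IsNoetherianRing R] (hR : isCompact C ≤ homFinite R)
    (G : (isCompact C).FullSubcategory)
    (hG : ∀ i : ℤ, Module.Finite R (H.obj (op (shiftObj G i)))) :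
    ∃ (X : ℕ ⥤ (isCompact C).FullSubcategory) (y : ∀ n, H.obj (op (X.obj n))),
      (∀ n, H.map (transition X n).op (y (n + 1)) = y n) ∧
      ∀ n : ℕ, ∀ i ∈ Set.Icc (-(n : ℤ)) n,
        Function.Surjective (hH.eval (y (n + 1)) (shiftObj G i)) ∧
        ∀ g : (shiftObj G i).obj ⟶ (X.obj n).obj, hH.eval (y n) (shiftObj G i) g = 0 →
          g ≫ (transition X n).hom = 0 := by
  choose E y f hf h using fun n : ℕ => hH.exists_next hR G hG (Set.finite_Icc (-(n : ℤ)) n)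
  let s : ℕ → Σ E : (isCompact C).FullSubcategory, H.obj (op E) := fun n =>
    Nat.rec ⟨⟨0, (isCompact C).prop_zero⟩, 0⟩ (fun n s => ⟨E n s.1 s.2, y n s.1 s.2⟩) n
  let X : ℕ ⥤ (isCompact C).FullSubcategory :=
    Functor.ofSequence (X := fun n => (s n).1) fun n => f n (s n).1 (s n).2
  have hX (n : ℕ) : transition X n = f n (s n).1 (s n).2 :=
    Functor.ofSequence_map_homOfLE_succ _ _
  refine ⟨X, fun n => (s n).2, fun n => ?_, fun n i hi => ⟨(h n _ _ i hi).1, fun g hg => ?_⟩⟩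
  · rw [hX]
    exact hf n _ _
  · rw [hX]
    exact (h n _ _ i hi).2 g hg

/-- A compatible family of elements of `H` along a sequence of compact objects defines a morphism to
`H` from the functor represented by the homotopy colimit of the sequence. -/
lemma exists_hom_of_isHocolim (X : ℕ ⥤ (isCompact C).FullSubcategory)
    (y : ∀ n, H.obj (op (X.obj n))) (hy : ∀ n, H.map (transition X n).op (y (n + 1)) = y n)
    {F : C} {ι : ∀ n, (X.obj n).obj ⟶ F} (hF : IsHocolim (X ⋙ (isCompact C).ι) F ι) :
    ∃ τ : (compactYoneda R C).obj F ⟶ H,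
      ∀ (K : (isCompact C).FullSubcategory) (n : ℕ) (g : K.obj ⟶ (X.obj n).obj),
        τ.app (op K) (g ≫ ι n) = hH.eval (y n) K g := by
  have hy' {m n : ℕ} (h : m ≤ n) : H.map (X.map (homOfLE h)).op (y n) = y m := by
    induction n, h using Nat.le_induction with
    | base =>
      rw [show homOfLE (le_refl m) = 𝟙 m from rfl, X.map_id, map_id_apply]
    | succ n hn ih =>
      rw [show homOfLE (hn.trans (Nat.le_succ n)) = homOfLE hn ≫ homOfLE (Nat.le_succ n) from rfl,
        X.map_comp, map_comp_apply, hy, ih]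
  have hev (K : (isCompact C).FullSubcategory) {m n : ℕ} (h : m ≤ n)
      (g : K.obj ⟶ (X.obj m).obj) :
      hH.eval (y n) K (g ≫ (X.map (homOfLE h)).hom) = hH.eval (y m) K g := by
    rw [hH.eval_comp, hy']
  have hι {m n : ℕ} (h : m ≤ n) : (X.map (homOfLE h)).hom ≫ ι n = ι m := hF.map_comp h
  -- The value of an evaluation map depends only on the morphism to the homotopy colimit.
  have hwd (K : (isCompact C).FullSubcategory) {m n : ℕ} (g : K.obj ⟶ (X.obj m).obj)
      (g' : K.obj ⟶ (X.obj n).obj) (h : g ≫ ι m = g' ≫ ι n) :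
      hH.eval (y m) K g = hH.eval (y n) K g' := by
    have hm := le_max_left m n
    have hn := le_max_right m n
    let k : K.obj ⟶ (X.obj (max m n)).obj :=
      g ≫ (X.map (homOfLE hm)).hom - g' ≫ (X.map (homOfLE hn)).hom
    have hk : k ≫ ι (max m n) = 0 := by
      rw [Preadditive.sub_comp, Category.assoc, Category.assoc, hι, hι, h, sub_self]
    obtain ⟨M, hM, h0⟩ := hF.exists_map_eq_zero K.property (n := max m n) k hk
    have h0' : k ≫ (X.map (homOfLE hM)).hom = 0 := h0
    have := hev K hM k
    rw [h0', _root_.map_zero, eq_comm, map_sub, hev, hev, sub_eq_zero] at this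
    exact this
  have hlift (K : (isCompact C).FullSubcategory) (φ : K.obj ⟶ F) :
      ∃ (n : ℕ) (g : K.obj ⟶ (X.obj n).obj), g ≫ ι n = φ := hF.exists_lift K.property φ
  have key (K : (isCompact C).FullSubcategory) : ∃ T : (K.obj ⟶ F) →ₗ[R] H.obj (op K),
      ∀ (n : ℕ) (g : K.obj ⟶ (X.obj n).obj), T (g ≫ ι n) = hH.eval (y n) K g := by
    choose n g hg using hlift K
    refine ⟨{ toFun := fun φ => hH.eval (y (n φ)) K (g φ)
              map_add' := fun φ ψ => ?_
              map_smul' := fun r φ => ?_ }, fun m k => hwd K _ _ (hg _)⟩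
    · have hm := le_max_left (n φ) (n ψ)
      have hn := le_max_right (n φ) (n ψ)
      rw [← hev K hm, ← hev K hn, ← _root_.map_add]
      refine hwd K _ _ ?_
      rw [hg, Preadditive.add_comp, Category.assoc, Category.assoc, hι, hι, hg, hg]
    · rw [RingHom.id_apply, ← _root_.map_smul]
      refine hwd K _ _ ?_
      rw [hg, Linear.smul_comp, hg]
  choose T hT using key
  refine ⟨{ app := fun K => ModuleCat.ofHom (T K.unop), naturality := fun K L f => ?_ },
    fun K n g => hT K n g⟩
  ext (φ : K.unop.obj ⟶ F)
  obtain ⟨n, g, rfl⟩ := hlift K.unop φ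
  change T L.unop (f.unop.hom ≫ g ≫ ι n) = H.map f (T K.unop (g ≫ ι n))
  rw [← Category.assoc, hT, hT]
  exact map_comp_apply H f.unop (ObjectProperty.homMk g) (y n)

/-- A cohomological functor whose values at the shifts of a compact generator are finite is
represented by an object of the whole category. -/
lemma exists_iso [IsNoetherianRing R] [IsTriangulated C] (hR : isCompact C ≤ homFinite R) {G : C}
    (hG : IsCompactGenerator G)
    (hfin : ∀ i : ℤ, Module.Finite R (H.obj (op (shiftObj ⟨G, hG.isCompact⟩ i)))) :
    ∃ F : C, Nonempty ((compactYoneda R C).obj F ≅ H) := by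
  obtain ⟨X, y, hy, h⟩ := hH.exists_sequence hR _ hfin
  obtain ⟨F, ι, hF⟩ := exists_isHocolim (X ⋙ (isCompact C).ι)
  obtain ⟨τ, hτ⟩ := hH.exists_hom_of_isHocolim X y hy hF
  have := hG.isIso_of_isCohomological (isCohomological_restrictedYoneda F) hH τ fun i => by
    constructor
    · refine (injective_iff_map_eq_zero (τ.app _).hom).2 fun φ hφ => ?_
      obtain ⟨n, g, rfl⟩ := hF.exists_lift ((isCompact C).le_shift i _ hG.isCompact) φ
      let N := max n i.natAbs
      have hN := hF.map_comp (le_max_left n i.natAbs)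
      have h0 : (g ≫ (X ⋙ (isCompact C).ι).map (homOfLE (le_max_left n i.natAbs))) ≫
          (transition X N).hom = 0 := by
        refine (h N i (Set.mem_Icc.2 (by omega))).2 _ ?_
        have h₁ : (g ≫ (X ⋙ (isCompact C).ι).map (homOfLE (le_max_left n i.natAbs))) ≫ ι N =
            g ≫ ι n := by rw [Category.assoc, hN]
        exact (hτ _ N _).symm.trans ((congr_arg (fun k : G⟦i⟧ ⟶ F =>
          τ.app (op (shiftObj ⟨G, hG.isCompact⟩ i)) k) h₁).trans hφ)
      rw [← hN, ← hF.transition_comp N, ← Category.assoc, ← Category.assoc]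
      exact (congr_arg (· ≫ ι (N + 1)) h0).trans zero_comp
    · intro z
      obtain ⟨g, hg⟩ := (h i.natAbs i (Set.mem_Icc.2 (by omega))).1 z
      exact ⟨g ≫ ι _, (hτ _ _ g).trans hg⟩
  exact ⟨F, ⟨asIso τ⟩⟩

end IsCohomological

end Representability

/-! ### The restricted Yoneda functor on objects approximated by compact objects -/

section IsoInvariance

variable {R : Type w} [CommRing R] {C : Type u} [Category.{v} C] [Preadditive C] [Linear R C]
  [HasZeroObject C] [HasShift C ℤ] [∀ n : ℤ, (shiftFunctor C n).Additive] [Pretriangulated C]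
  {P : ObjectProperty C} [P.IsStableUnderShift ℤ]
  {H H' : P.FullSubcategoryᵒᵖ ⥤ ModuleCat.{v} R}

lemma IsLocallyFinite.of_iso (hH : IsLocallyFinite H) (e : H ≅ H') : IsLocallyFinite H' where
  toIsCohomological := hH.toIsCohomological.of_iso e
  locallyFiniteAt K :=
    { finite := fun i =>
        haveI := (hH.locallyFiniteAt K).finite i
        Module.Finite.equiv (e.app (op (shiftObj K i))).toLinearEquiv
      isZero_of_le := by
        obtain ⟨N, hN⟩ := (hH.locallyFiniteAt K).isZero_of_le
        exact ⟨N, fun i hi => (hN i hi).of_iso (e.app (op (shiftObj K i))).symm⟩ }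

lemma IsFinite.of_iso (hH : IsFinite H) (e : H ≅ H') : IsFinite H' where
  toIsLocallyFinite := hH.toIsLocallyFinite.of_iso e
  isZero_of_ge K := by
    obtain ⟨N, hN⟩ := hH.isZero_of_ge K
    exact ⟨N, fun i hi => (hN i hi).of_iso (e.app (op (shiftObj K i))).symm⟩

end IsoInvariance

/-- A morphism from an object of `𝒯⁻_c` to an object which is bounded below vanishes if it does so
on compact objects. -/
lemma eq_zero_of_compactYoneda_map_eq_zero {R : Type w} [CommRing R] {C : Type u} [Category.{v} C]
    [Preadditive C] [Linear R C] [HasZeroObject C] [HasShift C ℤ]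
    [∀ n : ℤ, (shiftFunctor C n).Additive] [Pretriangulated C] {t : TStructure C} {s x : C} (hs : minusC t s) (hx : t.plus x) (f : s ⟶ x)
    (hf : (compactYoneda R C).map f = 0) : f = 0 := by
  obtain ⟨N, hN⟩ := hx
  obtain ⟨E, D, a, b, c, hT, hE, hD⟩ := hs (max 1 (1 - N)) (by omega)
  have h0 : a ≫ f = 0 :=
    congr_arg (fun τ : (compactYoneda R C).obj s ⟶ (compactYoneda R C).obj x =>
      τ.app (op ⟨E, hE⟩) a) hf
  obtain ⟨k, rfl⟩ := tri_desc hT f h0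
  rw [hom_eq_zero t (by omega) hD hN.ge k, comp_zero]

namespace ApproxData

variable {C : Type u} [Category.{v} C] [Preadditive C] [HasZeroObject C] [HasShift C ℤ]
  [∀ n : ℤ, (shiftFunctor C n).Additive] [Pretriangulated C] [IsTriangulated C]
  [HasCoproducts.{v} C] {G : C} {t : TStructure C} {A : ℕ} (d : ApproxData G t A)
include d

/-- The objects of `𝒯⁻_c` are homotopy colimits of compact objects. -/
lemma exists_isHocolim_of_minusC {F : C} (hF : minusC t F) :
    ∃ (X : ℕ ⥤ C) (e : ∀ n, X.obj n ⟶ F), IsHocolim X F e ∧ ∀ n, isCompact C (X.obj n) := by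
  obtain ⟨E, D, a, b, c, hT, hE, hD⟩ := hF 1 one_pos
  refine exists_isHocolim_of_approximation d.isCompactGenerator d.leOrthogonal_obj
    ⟨E, a, hE, D, b, c, hT, t.le_monotone (by omega) _ hD⟩ fun n ⟨E, a, hE, _⟩ => ?_
  -- A good enough approximation receives a morphism from the given one.
  obtain ⟨B, -, hB⟩ := d.exists_bound hE
  obtain ⟨E', D', a', b', c', hT', hE', hD'⟩ := hF (max (n + 1) B) (by omega)
  have h0 : a ≫ b' = 0 := hB D' (t.le_monotone (by omega) _ hD') _
  obtain ⟨u, hu⟩ := tri_lift hT' a h0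
  exact ⟨⟨E', a', hE', D', b', c', hT', t.le_monotone (by push_cast; omega) _ hD'⟩, u, hu⟩

lemma minus_of_minusC {F : C} (hF : minusC t F) : t.minus F := by
  obtain ⟨E, D, a, b, c, hT, hE, hD⟩ := hF 1 one_pos
  obtain ⟨B, hB, -⟩ := d.exists_bound hE
  exact ⟨max B (-1), ⟨le_ext t _ _ hT (t.le_monotone (le_max_left _ _) _ hB)
    (t.le_monotone (le_max_right _ _) _ hD)⟩⟩

/-- An object which receives no nonzero morphisms from the shifts `Σ⁻ⁱ G` for small `i` is bounded
below. -/
lemma plus_of_hom_eq_zero {F : C} {k : ℤ} (hF : ∀ i ≤ k, ∀ f : G⟦-i⟧ ⟶ F, f = 0) : t.plus F := by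
  refine ⟨k - A + 1, ⟨(ge_iff_hom_eq_zero t _ F).2 fun Y f hY => ?_⟩⟩
  have hY' : aisle G k Y :=
    (coprodClosure G (Set.Iic k)).retractClosure.prop_of_iso (shiftShiftNeg Y (k - A))
    (aisle_shift G (by omega) (d.le_aisle _ (le_shift' t (by omega) hY)))
  exact comp_eq_zero_of_retractClosure_coprodClosure (fun i hi => hF i hi) hY' f

section Linear

variable {R : Type w} [CommRing R] [Linear R C]

/-- Morphisms of functors from `𝒴(s)` with `s` in `𝒯⁻_c` come from morphisms of objects. -/
lemma exists_map_eq {s x : C} (hs : minusC t s)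
    (φ : (compactYoneda R C).obj s ⟶ (compactYoneda R C).obj x) :
    ∃ f : s ⟶ x, (compactYoneda R C).map f = φ := by
  obtain ⟨X, e, hX, hc⟩ := d.exists_isHocolim_of_minusC hs
  have nat {K L : (isCompact C).FullSubcategory} (g : K.obj ⟶ L.obj) (k : L.obj ⟶ s) :
      φ.app (op K) (g ≫ k) = g ≫ φ.app (op L) k :=
    naturality_op_apply φ (ObjectProperty.homMk g) k
  let E (n : ℕ) : (isCompact C).FullSubcategory := ⟨X.obj n, hc n⟩
  obtain ⟨f, hf⟩ := hX.exists_desc (Z := x) (fun n => φ.app (op (E n)) (e n)) fun n => by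
    refine (nat (K := E n) (L := E (n + 1)) (transition X n) (e (n + 1))).symm.trans ?_
    rw [hX.transition_comp]
  refine ⟨f, ?_⟩
  ext K (g : K.unop.obj ⟶ s)
  obtain ⟨n, g', rfl⟩ := hX.exists_lift K.unop.property g
  refine Eq.trans ?_ (nat (L := E n) g' (e n)).symm
  change (g' ≫ e n) ≫ f = _
  rw [Category.assoc, hf]

variable [IsNoetherianRing R] (hR : isCompact C ≤ homFinite R)
include hR

lemma homFinite_of_minusC {F : C} (hF : minusC t F) : homFinite R F := by
  intro K hK
  obtain ⟨B, -, hB⟩ := d.exists_bound hK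
  obtain ⟨E, D, a, b, c, hT, hE, hD⟩ := hF (max 1 B) (by omega)
  have := hR E hE K hK
  exact Module.Finite.of_surjective (Linear.rightComp R K a) fun φ =>
    tri_lift hT φ (hB D (t.le_monotone (by omega) _ hD) _)

lemma isLocallyFinite_of_minusC {F : C} (hF : minusC t F) :
    IsLocallyFinite ((compactYoneda R C).obj F) where
  toIsCohomological := isCohomological_restrictedYoneda F
  locallyFiniteAt K :=
    { finite := fun i => d.homFinite_of_minusC hR hF _ (shiftObj K i).property
      isZero_of_le := by
        obtain ⟨N, hN⟩ := d.minus_of_minusC hF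
        obtain ⟨B, -, hB⟩ := d.exists_bound K.property
        refine ⟨-B - N, fun i hi => ?_⟩
        have : Subsingleton (K.obj⟦i⟧ ⟶ F) :=
          subsingleton_of_forall_eq 0 (leOrthogonal_shift' t (by omega) hB F hN.le)
        exact ModuleCat.isZero_of_subsingleton (ModuleCat.of R (K.obj⟦i⟧ ⟶ F)) }

lemma isFinite_of_boundedC {F : C} (hF : boundedC t F) :
    IsFinite ((compactYoneda R C).obj F) where
  toIsLocallyFinite := d.isLocallyFinite_of_minusC hR hF.1
  isZero_of_ge K := by
    obtain ⟨N, hN⟩ := hF.2.1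
    obtain ⟨B, hB, -⟩ := d.exists_bound K.property
    refine ⟨B - N + 1, fun i hi => ?_⟩
    have : Subsingleton (K.obj⟦i⟧ ⟶ F) := subsingleton_of_forall_eq 0 fun f =>
      hom_eq_zero t (m := B - i) (by omega) (le_shift' t (by omega) hB) hN.ge f
    exact ModuleCat.isZero_of_subsingleton (ModuleCat.of R (K.obj⟦i⟧ ⟶ F))

variable [∀ n : ℤ, (shiftFunctor C n).Linear R]

lemma exists_iso_of_isLocallyFinite
    {H : (isCompact C).FullSubcategoryᵒᵖ ⥤ ModuleCat.{v} R} (hH : IsLocallyFinite H) :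
    ∃ F : C, minusC t F ∧ Nonempty ((compactYoneda R C).obj F ≅ H) := by
  have hG := hH.locallyFiniteAt ⟨G, d.isCompactGenerator.isCompact⟩
  obtain ⟨F, ⟨e⟩⟩ := hH.toIsCohomological.exists_iso hR d.isCompactGenerator hG.finite
  have hF := hH.of_iso e.symm
  refine ⟨F, d.minusC_of_homFinite hR (fun K hK => ?_) ?_, ⟨e⟩⟩
  · exact finite_hom_of_retract R (.ofIso ((shiftFunctorZero C ℤ).symm.app K)) (Retract.refl F)
      ((hF.locallyFiniteAt ⟨K, hK⟩).finite 0)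
  · obtain ⟨N, hN⟩ := (hF.locallyFiniteAt ⟨G, d.isCompactGenerator.isCompact⟩).isZero_of_le
    refine d.minus_of_hom_eq_zero (k := -N) fun i hi f => ?_
    have : Subsingleton (G⟦-i⟧ ⟶ F) := ModuleCat.subsingleton_of_isZero (hN (-i) (by omega))
    exact Subsingleton.elim _ _

lemma plus_of_isFinite {F : C} (hF : IsFinite ((compactYoneda R C).obj F)) : t.plus F := by
  obtain ⟨N, hN⟩ := hF.isZero_of_ge ⟨G, d.isCompactGenerator.isCompact⟩
  refine d.plus_of_hom_eq_zero (k := -N) fun i hi f => ?_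
  have : Subsingleton (G⟦-i⟧ ⟶ F) := ModuleCat.subsingleton_of_isZero (hN (-i) (by omega))
  exact Subsingleton.elim _ _

end Linear

end ApproxData

end ApproxTriang

theorem theoremT1 {R : Type w} [CommRing R] [IsNoetherianRing R]
    {C : Type u} [Category.{v} C] [Preadditive C] [Linear R C] [HasZeroObject C] [HasShift C ℤ]
    [∀ n : ℤ, (shiftFunctor C n).Additive] [∀ n : ℤ, (shiftFunctor C n).Linear R]
    [Pretriangulated C] [IsTriangulated C] [HasCoproducts.{v} C]
    (G : C) (hG : ApproxTriang.IsCompactGenerator G)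
    (hfin : ApproxTriang.IsLocallyFiniteAt
      ((ApproxTriang.compactYoneda R C).obj G) ⟨G, hG.isCompact⟩)
    (happ : ApproxTriang.IsApproximable C) :
    (∃ t : TStructure C, ApproxTriang.IsPreferred t) ∧
    ∀ t : TStructure C, ApproxTriang.IsPreferred t →
      (∀ (s x : C), ApproxTriang.minusC t s →
        ∀ φ : (ApproxTriang.compactYoneda R C).obj s ⟶
            (ApproxTriang.compactYoneda R C).obj x,
          ∃ f : s ⟶ x, (ApproxTriang.compactYoneda R C).map f = φ) ∧
      ((ApproxTriang.minusC t).ι ⋙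
        ApproxTriang.compactYoneda R C).Full ∧
      (∀ H : (ApproxTriang.isCompact C).FullSubcategoryᵒᵖ ⥤ ModuleCat.{v} R,
        ((ApproxTriang.minusC t).ι ⋙
          ApproxTriang.compactYoneda R C).essImage H ↔
            ApproxTriang.IsLocallyFinite H) ∧
      (∀ (s x : C), ApproxTriang.minusC t s → t.plus x → ∀ f : s ⟶ x,
        (ApproxTriang.compactYoneda R C).map f = 0 → f = 0) ∧
      ((ApproxTriang.boundedC t).ι ⋙
        ApproxTriang.compactYoneda R C).Full ∧
      ((ApproxTriang.boundedC t).ι ⋙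
        ApproxTriang.compactYoneda R C).Faithful ∧
      (∀ H : (ApproxTriang.isCompact C).FullSubcategoryᵒᵖ ⥤ ModuleCat.{v} R,
        ((ApproxTriang.boundedC t).ι ⋙
          ApproxTriang.compactYoneda R C).essImage H ↔
            ApproxTriang.IsFinite H) := by
  obtain ⟨G₀, t₀, A, d⟩ := happ.exists_approxData
  refine ⟨⟨t₀, d.isPreferred⟩, fun t ht => ?_⟩
  -- All preferred t-structures define the same subcategories.
  rw [ht.minusC_eq d.isPreferred, ht.boundedC_eq d.isPreferred, ht.plus_eq d.isPreferred]
  have hR := hG.isCompact_le_homFinite R hfin.finite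
  refine ⟨fun s x hs φ => d.exists_map_eq hs φ, ⟨fun {s x} φ => ?_⟩, fun H => ⟨?_, fun hH => ?_⟩,
    fun s x hs hx f hf => ApproxTriang.eq_zero_of_compactYoneda_map_eq_zero hs hx f hf,
    ⟨fun {s x} φ => ?_⟩, ⟨fun {s x} f g h => ?_⟩, fun H => ⟨?_, fun hH => ?_⟩⟩
  · obtain ⟨f, hf⟩ := d.exists_map_eq s.property φ
    exact ⟨ObjectProperty.homMk f, hf⟩
  · rintro ⟨F, ⟨e⟩⟩
    exact (d.isLocallyFinite_of_minusC hR F.property).of_iso e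
  · obtain ⟨F, hF, he⟩ := d.exists_iso_of_isLocallyFinite hR hH
    exact ⟨⟨F, hF⟩, he⟩
  · obtain ⟨f, hf⟩ := d.exists_map_eq s.property.1 φ
    exact ⟨ObjectProperty.homMk f, hf⟩
  · refine ObjectProperty.hom_ext _ (sub_eq_zero.1 ?_)
    refine ApproxTriang.eq_zero_of_compactYoneda_map_eq_zero (R := R) s.property.1 x.property.2.1 _ ?_
    ext K (k : K.unop.obj ⟶ s.obj)
    have hk : k ≫ f.hom = k ≫ g.hom :=
      congr_arg (fun τ : (ApproxTriang.compactYoneda R C).obj s.obj ⟶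
        (ApproxTriang.compactYoneda R C).obj x.obj => τ.app K k) h
    change k ≫ (f.hom - g.hom) = 0
    rw [Preadditive.comp_sub, hk, sub_self]
  · rintro ⟨F, ⟨e⟩⟩
    exact (d.isFinite_of_boundedC hR F.property).of_iso e
  · obtain ⟨F, hF, ⟨e⟩⟩ := d.exists_iso_of_isLocallyFinite hR hH.toIsLocallyFinite
    exact ⟨⟨F, hF, d.plus_of_isFinite hR (hH.of_iso e.symm), d.minus_of_minusC hF⟩, ⟨e⟩⟩
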